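/- Let $k,n\ge 1$ and let $\kappa$ be a nonzero complex number. Let $e_{ab}$, $1\le a,b\le k$, be the standard basis of $\mathfrak{gl}_k$, acting on $\mathbb V^{(k)}=\mathbb C[x_1,\dots,x_k]$ by $e_{ab}\mapsto x_a\,\partial/\partial x_b$; let $V_l\subset\mathbb V^{(k)}$ be the submodule of homogeneous polynomials of degree $l$. On $(\mathbb V^{(k)})^{\otimes n}$ write $g^{(i)}$ for the action of $g$ in the $i$-th factor, $A^{(ij)}$ for the action of an operator $A$ on the $i$-th and $j$-th factors, and $e_{ab}=\sum_{i=1}^n(e_{ab})^{(i)}$. Put $\Omega=\sum_{a,b}e_{ab}\otimes e_{ba}$, $\Omega_+=\frac12\sum_a e_{aa}\otimes e_{aa}+\sum_{a<b}e_{ab}\otimes e_{ba}$, $r(x)=\frac{\Omega}{x-1}+\Omega_+$. For functions of $z=(z_1,\dots,z_n)$ and $\lambda=(\lambda_1,\dots,\lambda_k)$ with values in $(\mathbb V^{(k)})^{\otimes n}$ define the rational and trigonometric KZ operators $$\nabla_{z_i}(z;\lambda)=\kappa\frac{\partial}{\partial z_i}-\sum_{a=1}^k\lambda_a(e_{aa})^{(i)}-\sum_{j\ne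 i}\frac{\Omega^{(ij)}}{z_i-z_j},$$ $$\widehat\nabla_{z_i}(z;\lambda)=\kappa z_i\frac{\partial}{\partial z_i}-\sum_{a=1}^k\Bigl(\lambda_a-\frac{e_{aa}}2\Bigr)(e_{aa})^{(i)}-\sum_{j\ne i}r^{(ij)}(z_i/z_j),$$ and the rational and trigonometric differential dynamical (DD) operators $$D_{\lambda_a}(z;\lambda)=\kappa\frac{\partial}{\partial\lambda_a}-\sum_{i=1}^nz_i(e_{aa})^{(i)}-\sum_{b\ne a}\frac{e_{ab}e_{ba}-e_{aa}}{\lambda_a-\lambda_b},$$ $$\widehat D_{\lambda_a}(z;\lambda)=\kappa\lambda_a\frac{\partial}{\partial\lambda_a}+\frac{e_{aa}^2}2-\sum_{i=1}^nz_i(e_{aa})^{(i)}-\sum_{b=1}^k\sum_{1\le i<j\le n}(e_{ab})^{(i)}(e_{ba})^{(j)}-\sum_{b\ne a}\frac{\lambda_b}{\lambda_a-\lambda_b}(e_{ab}e_{ba}-e_{aa}).$$ For $t\notin\mathbb Z$ put $$B_{ab}(t)=1+\sum_{s\ge1}e_{ba}^s\,e_{ab}^s\prod_{j=1}^s\frac1{j\,(t-e_{aa}+e_{bb}-j)},\qquad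 C_{ab}(t)=\frac{\Gamma(t+1)\,\Gamma(t-e_{aa}+e_{bb})}{\Gamma(t-e_{aa})\,\Gamma(t+e_{bb}+1)},$$ and let $R(t)\in\mathrm{End}(\mathbb V^{(k)}\otimes\mathbb V^{(k)})$ be the rational $R$-matrix, that is, the unique operator which preserves every $V_l\otimes V_m$, commutes with $g\otimes1+1\otimes g$ for all $g\in\mathfrak{gl}_k$, satisfies $$R(t)\Bigl(t\,e_{ab}\otimes1+\sum_{c}e_{ac}\otimes e_{cb}\Bigr)=\Bigl(t\,e_{ab}\otimes1+\sum_{c}e_{cb}\otimes e_{ac}\Bigr)R(t)\quad\text{for all }a,b,$$ and fixes every $x_1^l\otimes x_1^m$. Put $R_{ij}(t)=R(t)^{(ij)}$, $z_{ij}=z_i-z_j$, $\lambda_{ab}=\lambda_a-\lambda_b$. Let $T_{\lambda_a}$ and $T_{z_i}$ be the shifts $\lambda_a\mapsto\lambda_a+\kappa$ and $z_i\mapsto z_i+\kappa$ of the argument of a function. Define the rational difference dynamical (qDD) operators $Q_{\lambda_a}=X_aT_{\lambda_a}$ and the rational quantized KZ (qKZ) operators $Z_{z_i}=K_iT_{z_i}$,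 where $$X_a(z;\lambda)=\bigl(B_{ak}(\lambda_{ak})\cdots B_{a,a+1}(\lambda_{a,a+1})\bigr)^{-1}\prod_{i=1}^n\bigl(z_i^{-e_{aa}}\bigr)^{(i)}\,B_{1a}(\lambda_{1a}-\kappa)\cdots B_{a-1,a}(\lambda_{a-1,a}-\kappa),$$ $$K_i(z;\lambda)=\bigl(R_{in}(z_{in})\cdots R_{i,i+1}(z_{i,i+1})\bigr)^{-1}\prod_{a=1}^k\bigl(\lambda_a^{-e_{aa}}\bigr)^{(i)}\,R_{1i}(z_{1i}-\kappa)\cdots R_{i-1,i}(z_{i-1,i}-\kappa),$$ and put $$N_a(\lambda)=\prod_{1\le b<a}C_{ba}(\lambda_{ba}-\kappa)\prod_{a<b\le k}\bigl(C_{ab}(\lambda_{ab})\bigr)^{-1}.$$ The superscript $(k)$ marks these objects for $\mathfrak{gl}_k$. The superscript $(n)$ marks the same objects for $\mathfrak{gl}_n$ acting on $(\mathbb V^{(n)})^{\otimes k}$, with the roles of $(k,z,\lambda)$ and $(n,\lambda,z)$ exchanged. Let $\mathbb P_{kn}=\mathbb C[x_{ai}\mid 1\le a\le k,\ 1\le i\le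 n]$, identified with $(\mathbb V^{(k)})^{\otimes n}$ by $p_1\otimes\cdots\otimes p_n\mapsto\prod_{i}p_i(x_{1i},\dots,x_{ki})$ and with $(\mathbb V^{(n)})^{\otimes k}$ by $p_1\otimes\cdots\otimes p_k\mapsto\prod_{a}p_a(x_{a1},\dots,x_{an})$. For an operator $F$ of the first kind and an operator $G$ of the second kind write $F\simeq G$ if they act in the same way on $\mathbb P_{kn}$-valued functions of $z$ and $\lambda$. **Theorem.** For all $i=1,\dots,n$ and $a=1,\dots,k$, $$\nabla^{(k)}_{z_i}(z;\lambda)\simeq D^{(n)}_{z_i}(\lambda;z),\qquad D^{(k)}_{\lambda_a}(z;\lambda)\simeq\nabla^{(n)}_{\lambda_a}(\lambda;z),$$ $$\widehat\nabla^{(k)}_{z_i}(z;\lambda)\simeq\widehat D^{(n)}_{z_i}(\lambda;z),\qquad\widehat D^{(k)}_{\lambda_a}(z;\lambda)\simeq\widehat\nabla^{(n)}_{\lambda_a}(\lambda;z),$$ $$Z^{(k)}_{z_i}(z;\lambda)\simeq N^{(n)}_i(z)\,Q^{(n)}_{z_i}(\lambda;z),\qquad N^{(k)}_a(\lambda)\,Q^{(k)}_{\lambda_a}(z;\lambda)\simeq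 Z^{(n)}_{\lambda_a}(\lambda;z).$$ Each equality is understood at the points where its coefficients are regular. For the first column these are: $z_i\ne z_j$ for $j\ne i$ in the first line; in addition $z_j\ne0$ for $j\neq i$ in the second line; $\lambda_b\ne0$ for all $b$, $z_{ij}\notin\mathbb Z$ for $j>i$ and $z_{ji}-\kappa\notin\mathbb Z$ for $j<i$ in the third line. For the second column the same conditions hold with $z$ and $\lambda$, $i$ and $a$ exchanged. -/

import Mathlib

open scoped TensorProduct

noncomputable section

namespace KZDuality

/-! ### Polynomial modules and tensor products -/

/-- The `gl_k`-module `𝕍^(k) = ℂ[x_1, …, x_k]`. -/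
abbrev VV (k : ℕ) : Type := MvPolynomial (Fin k) ℂ

/-- The tensor product `(𝕍^(k))^{⊗ n}`. -/
abbrev TT (k n : ℕ) : Type := ⨂[ℂ] _ : Fin n, VV k

/-- The polynomial ring `P_kn` in the variables `x_{ai}`, `a = 1, …, k`, `i = 1, …, n`. -/
abbrev PP (k n : ℕ) : Type := MvPolynomial (Fin k × Fin n) ℂ

/-- The action of `e_{ab} ∈ gl_k` on `𝕍^(k)`, that is, the operator `x_a ∂_b`. -/
def e {k : ℕ} (a b : Fin k) : Module.End ℂ (VV k) :=
  LinearMap.mulLeft ℂ (MvPolynomial.X a : VV k) * (MvPolynomial.pderiv b : Derivation ℂ (VV k) (VV k))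

/-- The operator `f^{(i)}`, acting as `f` on the `i`-th tensor factor and as the identity on all
other tensor factors. -/
def onFactor {k n : ℕ} (i : Fin n) (f : Module.End ℂ (VV k)) : Module.End ℂ (TT k n) :=
  PiTensorProduct.map (Function.update (fun _ => LinearMap.id) i f)

/-- The linear map `𝕍 ⊗ 𝕍 → 𝕍^{⊗ n}` putting `p ⊗ q` on the `i`-th and `j`-th places and
keeping the vectors `v_m` on the other places. -/
def insertPair {k n : ℕ} {i j : Fin n} (h : i ≠ j) (v : Fin n → VV k) :
    (VV k ⊗[ℂ] VV k) →ₗ[ℂ] TT k n :=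
  TensorProduct.lift (LinearMap.mk₂ ℂ
    (fun p q => PiTensorProduct.tprod ℂ (Function.update (Function.update v i p) j q))
    (fun p p' q => by
      simp only [Function.update_comm (β := fun _ => VV k) h _ q, MultilinearMap.map_update_add])
    (fun c p q => by
      simp only [Function.update_comm (β := fun _ => VV k) h _ q, MultilinearMap.map_update_smul])
    (fun p q q' => by simp only [MultilinearMap.map_update_add])
    (fun c p q => by simp only [MultilinearMap.map_update_smul]))

theorem insertPair_tmul {k n : ℕ} {i j : Fin n} (h : i ≠ j) (v : Fin n → VV k) (p q : VV k) :
    insertPair h v (p ⊗ₜ q) =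
      PiTensorProduct.tprod ℂ (Function.update (Function.update v i p) j q) := rfl

theorem insertPair_update_left {k n : ℕ} {i j : Fin n} (h : i ≠ j) (v : Fin n → VV k) (x : VV k) :
    insertPair h (Function.update v i x) = insertPair h v := by
  refine TensorProduct.ext' fun p q => ?_
  simp [insertPair_tmul]

theorem insertPair_update_right {k n : ℕ} {i j : Fin n} (h : i ≠ j) (v : Fin n → VV k)
    (x : VV k) : insertPair h (Function.update v j x) = insertPair h v := by
  refine TensorProduct.ext' fun p q => ?_
  rw [insertPair_tmul, insertPair_tmul, Function.update_comm (β := fun _ => VV k) h.symm x p,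
    Function.update_idem]

theorem insertPair_update_add {k n : ℕ} {i j m : Fin n} (h : i ≠ j) (hi : m ≠ i) (hj : m ≠ j)
    (v : Fin n → VV k) (x y : VV k) :
    insertPair h (Function.update v m (x + y)) =
      insertPair h (Function.update v m x) + insertPair h (Function.update v m y) := by
  refine TensorProduct.ext' fun p q => ?_
  simp only [insertPair_tmul, LinearMap.add_apply, Function.update_comm (β := fun _ => VV k) hi,
    Function.update_comm (β := fun _ => VV k) hj, MultilinearMap.map_update_add]

theorem insertPair_update_smul {k n : ℕ} {i j m : Fin n} (h : i ≠ j) (hi : m ≠ i) (hj : m ≠ j)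
    (v : Fin n → VV k) (c : ℂ) (x : VV k) :
    insertPair h (Function.update v m (c • x)) = c • insertPair h (Function.update v m x) := by
  refine TensorProduct.ext' fun p q => ?_
  simp only [insertPair_tmul, LinearMap.smul_apply, Function.update_comm (β := fun _ => VV k) hi,
    Function.update_comm (β := fun _ => VV k) hj, MultilinearMap.map_update_smul]

/-- The operator `A^{(ij)}`, `i ≠ j`, acting as `A` on the product of the `i`-th and `j`-th tensor
factors (in this order) and as the identity on all other tensor factors. -/
def onPair {k n : ℕ} {i j : Fin n} (h : i ≠ j) (A : Module.End ℂ (VV k ⊗[ℂ] VV k)) :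
    Module.End ℂ (TT k n) :=
  PiTensorProduct.lift
    { toFun := fun v => insertPair h v (A (v i ⊗ₜ v j))
      map_update_add' := by
        intro inst v m x y
        rw [Subsingleton.elim inst (instDecidableEqFin n)]
        by_cases hi : m = i
        · subst hi
          simp [insertPair_update_left, h.symm, TensorProduct.add_tmul]
        · by_cases hj : m = j
          · subst hj
            simp [insertPair_update_right, h, TensorProduct.tmul_add]
          · simp [insertPair_update_add h hi hj, Ne.symm hi, Ne.symm hj]
      map_update_smul' := by
        intro inst v m c x
        rw [Subsingleton.elim inst (instDecidableEqFin n)]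
        by_cases hi : m = i
        · subst hi
          simp only [insertPair_update_left, Function.update_self, ne_eq, h.symm, not_false_eq_true, Function.update_of_ne,
            ← TensorProduct.smul_tmul', map_smul]
        · by_cases hj : m = j
          · subst hj
            simp [insertPair_update_right, h]
          · simp [insertPair_update_smul h hi hj, Ne.symm hi, Ne.symm hj] }

/-- The algebra homomorphism `ℂ[x_1, …, x_k]^{⊗ n} → ℂ[σ]` which sends `p_1 ⊗ ⋯ ⊗ p_n` to
`∏_i p_i(x_{g(i,1)}, …, x_{g(i,k)})`. -/
def polyHom {k n : ℕ} {σ : Type} (g : Fin n × Fin k → σ) : TT k n →ₐ[ℂ] MvPolynomial σ ℂ :=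
  PiTensorProduct.liftAlgHom
    ((MultilinearMap.mkPiAlgebra ℂ (Fin n) (MvPolynomial σ ℂ)).compLinearMap
      fun i => (MvPolynomial.rename (R := ℂ) fun a => g (i, a)).toLinearMap)
    (by
      rw [MultilinearMap.compLinearMap_apply, MultilinearMap.mkPiAlgebra_apply]
      exact Finset.prod_eq_one fun i _ => map_one (MvPolynomial.rename (R := ℂ) fun a => g (i, a)))
    (by
      intro x y
      simp only [MultilinearMap.compLinearMap_apply, MultilinearMap.mkPiAlgebra_apply,
        AlgHom.toLinearMap_apply, Pi.mul_apply, map_mul, Finset.prod_mul_distrib])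

theorem polyHom_tprod {k n : ℕ} {σ : Type} (g : Fin n × Fin k → σ) (p : Fin n → VV k) :
    polyHom g (PiTensorProduct.tprod ℂ p) =
      ∏ i, MvPolynomial.rename (fun a => g (i, a)) (p i) :=
  PiTensorProduct.lift.tprod p

theorem polyHom_single {k n : ℕ} {σ : Type} (g : Fin n × Fin k → σ) (i : Fin n) (a : Fin k) :
    polyHom g (PiTensorProduct.singleAlgHom (R := ℂ) (A := fun _ : Fin n => VV k) i
      (MvPolynomial.X a)) = MvPolynomial.X (g (i, a)) := by
  refine (polyHom_tprod g (Pi.mulSingle i (MvPolynomial.X a))).trans ?_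
  rw [Finset.prod_eq_single i]
  · simp
  · intro b _ hb
    simp [Pi.mulSingle_eq_of_ne hb]
  · simp

/-- `polyHom g` is an isomorphism when `g` is an identification of the pairs with `σ`. -/
def polyIso {k n : ℕ} {σ : Type} (g : Fin n × Fin k ≃ σ) : TT k n ≃ₐ[ℂ] MvPolynomial σ ℂ :=
  AlgEquiv.ofAlgHom (polyHom g)
    (MvPolynomial.aeval fun s =>
      PiTensorProduct.singleAlgHom (R := ℂ) (A := fun _ : Fin n => VV k) (g.symm s).1
        (MvPolynomial.X (g.symm s).2))
    (by
      refine MvPolynomial.algHom_ext fun s => ?_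
      rw [AlgHom.comp_apply, MvPolynomial.aeval_X, polyHom_single]
      simp)
    (by
      refine PiTensorProduct.algHom_ext fun i => MvPolynomial.algHom_ext fun a => ?_
      rw [AlgHom.comp_apply, AlgHom.comp_apply, polyHom_single, MvPolynomial.aeval_X]
      simp)

theorem polyIso_tprod {k n : ℕ} {σ : Type} (g : Fin n × Fin k ≃ σ) (p : Fin n → VV k) :
    polyIso g (PiTensorProduct.tprod ℂ p) =
      ∏ i, MvPolynomial.rename (fun a => g (i, a)) (p i) :=
  polyHom_tprod g p

/-- The isomorphism `(𝕍^(k))^{⊗ n} → P_kn`,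
`p_1 ⊗ ⋯ ⊗ p_n ↦ ∏_i p_i(x_{1i}, …, x_{ki})`. -/
def kIso (k n : ℕ) : TT k n ≃ₗ[ℂ] PP k n := (polyIso (Equiv.prodComm _ _)).toLinearEquiv

/-- The isomorphism `(𝕍^(n))^{⊗ k} → P_kn`,
`p_1 ⊗ ⋯ ⊗ p_k ↦ ∏_a p_a(x_{a1}, …, x_{an})`. -/
def nIso (k n : ℕ) : TT n k ≃ₗ[ℂ] PP k n := (polyIso (Equiv.refl _)).toLinearEquiv

/-- `(e_{ab})^{(i)}` on `(𝕍^(k))^{⊗ n}`. -/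
def eAt {k n : ℕ} (i : Fin n) (a b : Fin k) : Module.End ℂ (TT k n) := onFactor i (e a b)

/-- `e_{ab} = ∑_i (e_{ab})^{(i)}` on `(𝕍^(k))^{⊗ n}`. -/
def eTot {k : ℕ} (n : ℕ) (a b : Fin k) : Module.End ℂ (TT k n) := ∑ i, eAt i a b

/-- `Ω^{(ij)} = ∑_{a,b} (e_{ab})^{(i)} (e_{ba})^{(j)}`. -/
def Om {k n : ℕ} (i j : Fin n) : Module.End ℂ (TT k n) :=
  ∑ a : Fin k, ∑ b : Fin k, eAt i a b * eAt j b a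

/-- `Ω_+^{(ij)}`, where
`Ω_+ = (1/2) ∑_a e_{aa} ⊗ e_{aa} + ∑_{a < b} e_{ab} ⊗ e_{ba}`. -/
def OmPlus {k n : ℕ} (i j : Fin n) : Module.End ℂ (TT k n) :=
  (1 / 2 : ℂ) • (∑ a : Fin k, eAt i a a * eAt j a a) +
    ∑ a : Fin k, ∑ b : Fin k with a < b, eAt i a b * eAt j b a

/-- `r^{(ij)}(x)`, where `r(x) = Ω / (x - 1) + Ω_+` is the trigonometric `r`-matrix. -/
def rTrig {k n : ℕ} (x : ℂ) (i j : Fin n) : Module.End ℂ (TT k n) :=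
  (1 / (x - 1)) • Om i j + OmPlus i j

/-! ### Functions, derivatives and differential operators -/

/-- `M`-valued functions of `z_1, …, z_n` and `λ_1, …, λ_k`. -/
abbrev Fn (k n : ℕ) (M : Type) : Type := (Fin n → ℂ) → (Fin k → ℂ) → M

open Classical in
/-- The derivative at `x` of a function with values in a complex vector space: the vector whose
image under every linear functional `φ` is the derivative of `φ ∘ f`
(and `0` if there is no such vector). -/
def vderiv {M : Type} [AddCommGroup M] [Module ℂ M] (f : ℂ → M) (x : ℂ) : M :=
  if h : ∃ v : M, ∀ φ : Module.Dual ℂ M, HasDerivAt (fun y => φ (f y)) (φ v) x then h.choose else 0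

/-- `∂u / ∂z_i`. -/
def dz {k n : ℕ} {M : Type} [AddCommGroup M] [Module ℂ M] (i : Fin n) (u : Fn k n M) : Fn k n M :=
  fun z lam => vderiv (fun s => u (Function.update z i s) lam) (z i)

/-- `∂u / ∂λ_a`. -/
def dlam {k n : ℕ} {M : Type} [AddCommGroup M] [Module ℂ M] (a : Fin k) (u : Fn k n M) :
    Fn k n M :=
  fun z lam => vderiv (fun s => u z (Function.update lam a s)) (lam a)

/-- The rational KZ operator `∇_{z_i}(z; λ)` of `gl_k`. -/
def ratKZ {k n : ℕ} (κ : ℂ) (i : Fin n) (u : Fn k n (TT k n)) : Fn k n (TT k n) := fun z lam =>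
  κ • dz i u z lam
    - (∑ a, lam a • eAt i a a : Module.End ℂ (TT k n)) (u z lam)
    - (∑ j with j ≠ i, (1 / (z i - z j)) • Om i j : Module.End ℂ (TT k n)) (u z lam)

/-- The trigonometric KZ operator `∇̂_{z_i}(z; λ)` of `gl_k`. -/
def trigKZ {k n : ℕ} (κ : ℂ) (i : Fin n) (u : Fn k n (TT k n)) : Fn k n (TT k n) := fun z lam =>
  (κ * z i) • dz i u z lam
    - (∑ a, (lam a • 1 - (1 / 2 : ℂ) • eTot n a a) * eAt i a a : Module.End ℂ (TT k n)) (u z lam)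
    - (∑ j with j ≠ i, rTrig (z i / z j) i j : Module.End ℂ (TT k n)) (u z lam)

/-- The rational DD operator `D_{λ_a}(z; λ)` of `gl_k`. -/
def ratDD {k n : ℕ} (κ : ℂ) (a : Fin k) (u : Fn k n (TT k n)) : Fn k n (TT k n) := fun z lam =>
  κ • dlam a u z lam
    - (∑ i, z i • eAt i a a : Module.End ℂ (TT k n)) (u z lam)
    - (∑ b with b ≠ a, (1 / (lam a - lam b)) • (eTot n a b * eTot n b a - eTot n a a) :
        Module.End ℂ (TT k n)) (u z lam)

/-- The trigonometric DD operator `D̂_{λ_a}(z; λ)` of `gl_k`. -/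
def trigDD {k n : ℕ} (κ : ℂ) (a : Fin k) (u : Fn k n (TT k n)) : Fn k n (TT k n) := fun z lam =>
  (κ * lam a) • dlam a u z lam
    + ((1 / 2 : ℂ) • (eTot n a a) ^ 2 : Module.End ℂ (TT k n)) (u z lam)
    - (∑ i, z i • eAt i a a : Module.End ℂ (TT k n)) (u z lam)
    - (∑ b : Fin k, ∑ i : Fin n, ∑ j : Fin n with i < j, eAt i a b * eAt j b a :
        Module.End ℂ (TT k n)) (u z lam)
    - (∑ b with b ≠ a, (lam b / (lam a - lam b)) • (eTot n a b * eTot n b a - eTot n a a) :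
        Module.End ℂ (TT k n)) (u z lam)

/-! ### Functions of operators, the series `B_{ab}` and the operators `C_{ab}` -/

open Classical in
/-- `f(A)` for a diagonalizable operator `A`: the operator acting as multiplication by `f(μ)` on the
eigenspace of `A` with eigenvalue `μ`. It is unique when the eigenspaces of `A` span `M`. -/
def opFun {M : Type} [AddCommGroup M] [Module ℂ M] (f : ℂ → ℂ) (A : Module.End ℂ M) :
    Module.End ℂ M :=
  if h : ∃ T : Module.End ℂ M, ∀ (μ : ℂ) (v : M), A v = μ • v → T v = f μ • v then h.choose else 0

open Classical in
/-- The sum `∑_s A_s` of a series of operators such that every vector is annihilated by all but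
finitely many of them (and `0` for other series). -/
def opSeries {M : Type} [AddCommGroup M] [Module ℂ M] (A : ℕ → Module.End ℂ M) :
    Module.End ℂ M :=
  if h : ∀ v : M, (Function.support fun s => A s v).Finite then
    { toFun := fun v => ∑ᶠ s, A s v
      map_add' := fun v w => by
        simp only [map_add]
        exact finsum_add_distrib (h v) (h w)
      map_smul' := fun c v => by
        simp only [map_smul, RingHom.id_apply]
        exact (smul_finsum' c (h v)).symm }
  else 0

/-- `B_{ab}(t) = 1 + ∑_{s ≥ 1} e_{ba}^s e_{ab}^s ∏_{j=1}^s 1 / (j (t - e_{aa} + e_{bb} - j))`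
on `(𝕍^(k))^{⊗ n}`; the term with `s = 0` is `1`. -/
def BB {k : ℕ} (n : ℕ) (a b : Fin k) (t : ℂ) : Module.End ℂ (TT k n) :=
  opSeries fun s => eTot n b a ^ s * eTot n a b ^ s *
    ((List.range s).map fun j : ℕ =>
      Ring.inverse (((j : ℂ) + 1) • ((t - ((j : ℂ) + 1)) • 1 - eTot n a a + eTot n b b) :
        Module.End ℂ (TT k n))).prod

/-- `C_{ab}(t) = Γ(t + 1) Γ(t - e_{aa} + e_{bb}) / (Γ(t - e_{aa}) Γ(t + e_{bb} + 1))`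
on `(𝕍^(k))^{⊗ n}`. -/
def CC {k : ℕ} (n : ℕ) (a b : Fin k) (t : ℂ) : Module.End ℂ (TT k n) :=
  Complex.Gamma (t + 1) •
    (opFun (fun μ => Complex.Gamma (t - μ)) (eTot n a a - eTot n b b) *
      opFun (fun μ => (Complex.Gamma (t - μ))⁻¹) (eTot n a a) *
      opFun (fun μ => (Complex.Gamma (t + μ + 1))⁻¹) (eTot n b b))

/-! ### The rational `R`-matrix -/

/-- `V_l ⊗ V_m ⊆ 𝕍 ⊗ 𝕍`, where `V_l` is the space of homogeneous polynomials of degree `l`. -/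
def VlVm (k l m : ℕ) : Submodule ℂ (VV k ⊗[ℂ] VV k) :=
  LinearMap.range (TensorProduct.map (MvPolynomial.homogeneousSubmodule (Fin k) ℂ l).subtype
    (MvPolynomial.homogeneousSubmodule (Fin k) ℂ m).subtype)

/-- `g ⊗ h` as an operator on `𝕍 ⊗ 𝕍`. -/
abbrev tens {k : ℕ} (g h : Module.End ℂ (VV k)) : Module.End ℂ (VV k ⊗[ℂ] VV k) :=
  TensorProduct.map g h

/-- The properties which determine the rational `R`-matrix `R_{𝕍𝕍}(t) = ⊕ R_{V_l V_m}(t)`: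
it preserves every `V_l ⊗ V_m`, commutes with the action of `gl_k`, satisfies
`R (t e_{ab} ⊗ 1 + ∑_c e_{ac} ⊗ e_{cb}) = (t e_{ab} ⊗ 1 + ∑_c e_{cb} ⊗ e_{ac}) R`
and fixes the product `x_1^l ⊗ x_1^m` of the highest weight vectors of `V_l` and `V_m`. -/
structure IsRMatrix {k : ℕ} [NeZero k] (t : ℂ) (R : Module.End ℂ (VV k ⊗[ℂ] VV k)) : Prop where
  preserves : ∀ l m : ℕ, ∀ w ∈ VlVm k l m, R w ∈ VlVm k l m
  invariant : ∀ a b : Fin k, R * (tens (e a b) 1 + tens 1 (e a b)) =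
    (tens (e a b) 1 + tens 1 (e a b)) * R
  relation : ∀ a b : Fin k,
    R * (t • tens (e a b) 1 + ∑ c, tens (e a c) (e c b)) =
      (t • tens (e a b) 1 + ∑ c, tens (e c b) (e a c)) * R
  normalized : ∀ l m : ℕ,
    R ((MvPolynomial.X 0 ^ l : VV k) ⊗ₜ[ℂ] (MvPolynomial.X 0 ^ m : VV k)) =
      (MvPolynomial.X 0 ^ l : VV k) ⊗ₜ[ℂ] (MvPolynomial.X 0 ^ m : VV k)

open Classical in
/-- The rational `R`-matrix `R_{𝕍𝕍}(t)`: the unique operator with the defining properties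
(its poles are integers; the value is `0` where there is no such unique operator). -/
def RMat (k : ℕ) [NeZero k] (t : ℂ) : Module.End ℂ (VV k ⊗[ℂ] VV k) :=
  if h : ∃! R : Module.End ℂ (VV k ⊗[ℂ] VV k), IsRMatrix t R then h.choose else 0

open Classical in
/-- `R_{ij}(t) = (R_{𝕍𝕍}(t))^{(ij)}` for `i ≠ j`. -/
def RR {k n : ℕ} [NeZero k] (i j : Fin n) (t : ℂ) : Module.End ℂ (TT k n) :=
  if h : i ≠ j then onPair h (RMat k t) else 1

/-! ### Difference operators -/

/-- The indices greater than `a` in decreasing order. -/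
def above {m : ℕ} (a : Fin m) : List (Fin m) := ((List.finRange m).filter (a < ·)).reverse

/-- The indices less than `a` in increasing order. -/
def below {m : ℕ} (a : Fin m) : List (Fin m) := (List.finRange m).filter (· < a)

/-- `X_a(z; λ) = (B_{ak}(λ_{ak}) ⋯ B_{a,a+1}(λ_{a,a+1}))⁻¹ ∏_i (z_i^{-e_{aa}})^{(i)} ·
B_{1a}(λ_{1a} - κ) ⋯ B_{a-1,a}(λ_{a-1,a} - κ)` with `λ_{bc} = λ_b - λ_c`. -/
def XX {k n : ℕ} (κ : ℂ) (a : Fin k) (z : Fin n → ℂ) (lam : Fin k → ℂ) :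
    Module.End ℂ (TT k n) :=
  Ring.inverse ((above a).map fun b => BB n a b (lam a - lam b)).prod *
    ((List.finRange n).map fun i => onFactor i (opFun (fun μ => z i ^ (-μ)) (e a a))).prod *
    ((below a).map fun b => BB n b a (lam b - lam a - κ)).prod

/-- The rational qDD operator `Q_{λ_a}(z; λ) = X_a(z; λ) T_{λ_a}` of `gl_k`, where
`T_{λ_a}` shifts `λ_a` to `λ_a + κ`. -/
def ratQDD {k n : ℕ} (κ : ℂ) (a : Fin k) (u : Fn k n (TT k n)) : Fn k n (TT k n) := fun z lam =>
  XX κ a z lam (u z (Function.update lam a (lam a + κ)))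

/-- `K_i(z; λ) = (R_{in}(z_{in}) ⋯ R_{i,i+1}(z_{i,i+1}))⁻¹ ∏_a (λ_a^{-e_{aa}})^{(i)} ·
R_{1i}(z_{1i} - κ) ⋯ R_{i-1,i}(z_{i-1,i} - κ)` with `z_{ij} = z_i - z_j`. -/
def KK {k n : ℕ} [NeZero k] (κ : ℂ) (i : Fin n) (z : Fin n → ℂ) (lam : Fin k → ℂ) :
    Module.End ℂ (TT k n) :=
  Ring.inverse ((above i).map fun j => RR i j (z i - z j)).prod *
    ((List.finRange k).map fun a => onFactor i (opFun (fun μ => lam a ^ (-μ)) (e a a))).prod *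
    ((below i).map fun j => RR j i (z j - z i - κ)).prod

/-- The rational qKZ operator `Z_{z_i}(z; λ) = K_i(z; λ) T_{z_i}` of `gl_k`, where
`T_{z_i}` shifts `z_i` to `z_i + κ`. -/
def ratQKZ {k n : ℕ} [NeZero k] (κ : ℂ) (i : Fin n) (u : Fn k n (TT k n)) : Fn k n (TT k n) :=
  fun z lam => KK κ i z lam (u (Function.update z i (z i + κ)) lam)

/-- `N_a(λ) = ∏_{b < a} C_{ba}(λ_{ba} - κ) ∏_{a < b} C_{ab}(λ_{ab})⁻¹` for `gl_k`,
on `(𝕍^(k))^{⊗ n}`. -/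
def NN {k : ℕ} (n : ℕ) (κ : ℂ) (a : Fin k) (lam : Fin k → ℂ) : Module.End ℂ (TT k n) :=
  ((below a).map fun b => CC n b a (lam b - lam a - κ)).prod *
    ((above a).map fun b => Ring.inverse (CC n a b (lam a - lam b))).prod

/-- The normalized rational qDD operator `N_a(λ) Q_{λ_a}(z; λ)` of `gl_k`. -/
def normQDD {k n : ℕ} (κ : ℂ) (a : Fin k) (u : Fn k n (TT k n)) : Fn k n (TT k n) := fun z lam =>
  NN n κ a lam (ratQDD κ a u z lam)

/-! ### Comparison of the two actions on `P_kn`-valued functions -/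

/-- The action on `P_kn`-valued functions of an operator for `gl_k`, acting on
`(𝕍^(k))^{⊗ n}`-valued functions of `(z; λ)`. -/
def actK {k n : ℕ} (F : Fn k n (TT k n) → Fn k n (TT k n)) (u : Fn k n (PP k n)) :
    Fn k n (PP k n) := fun z lam =>
  kIso k n (F (fun z' lam' => (kIso k n).symm (u z' lam')) z lam)

/-- The action on `P_kn`-valued functions of an operator for `gl_n`, acting on
`(𝕍^(n))^{⊗ k}`-valued functions of `(λ; z)`. -/
def actN {k n : ℕ} (G : Fn n k (TT n k) → Fn n k (TT n k)) (u : Fn k n (PP k n)) :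
    Fn k n (PP k n) := fun z lam =>
  nIso k n (G (fun lam' z' => (nIso k n).symm (u z' lam')) lam z)

/-- `F ≃ G` at the points `(z; λ)` satisfying `S`: an operator `F` for `gl_k` and an operator `G`
for `gl_n` act on all `P_kn`-valued functions in the same way at these points. -/
def SimOn {k n : ℕ} (S : (Fin n → ℂ) → (Fin k → ℂ) → Prop)
    (F : Fn k n (TT k n) → Fn k n (TT k n)) (G : Fn n k (TT n k) → Fn n k (TT n k)) : Prop :=
  ∀ u : Fn k n (PP k n), ∀ z lam, S z lam → actK F u z lam = actN G u z lam

/-- The points where the coefficients `1 / (x_i - x_j)` are regular. -/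
def RatReg {m : ℕ} (i : Fin m) (x : Fin m → ℂ) : Prop := ∀ j, j ≠ i → x i ≠ x j

/-- The points where the coefficients depending on `x_i / x_j` are regular. -/
def TrigReg {m : ℕ} (i : Fin m) (x : Fin m → ℂ) : Prop := ∀ j, j ≠ i → x j ≠ 0 ∧ x i ≠ x j

/-- The points where the arguments `x_{ij}`, `i < j`, and `x_{ji} - κ`, `j < i`, avoid the poles,
which are integers. -/
def DiffReg {m : ℕ} (κ : ℂ) (i : Fin m) (x : Fin m → ℂ) : Prop :=
  (∀ j, i < j → ∀ s : ℤ, x i - x j ≠ s) ∧ (∀ j, j < i → ∀ s : ℤ, x j - x i - κ ≠ s)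

end KZDuality

end

open KZDuality

/-! Both Lie algebras act on `P_kn` through one Weyl algebra: `(e_ab)^{(i)}` for `gl_k` becomes
`x_{ai} ∂_{bi}`, and `(e_ij)^{(a)}` for `gl_n` becomes `x_{ai} ∂_{aj}`. The dualities are identities
between operators written in these generators; `opK` and `opN` carry out the translation.

Differential operators. The products `x_{ai} ∂_{bi} x_{bj} ∂_{aj}` and `x_{ai} ∂_{aj} x_{bj} ∂_{bi}`
have the same normally ordered part and differ only when `a = b` (`exchange`). Summing over `a, b`
turns `Ω^{(ij)}` into `e_ij e_ji - e_ii` (`opK_Om`), which settles the rational case; the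
trigonometric case also needs bookkeeping of quadratic terms (`opK_trigKZ`).

Difference operators. The key fact is that `R_{ij}(t)` for `gl_k` equals `C_{ij}(t) B_{ij}(t)` for
`gl_n` (`opK_RR`). Regard `𝕍 ⊗ 𝕍` as polynomials in two sets of variables `x_a`, `y_a`. A dual
`gl_2`, with `E = ∑ x_a ∂_{y_a}` and `F = ∑ y_a ∂_{x_a}`, commutes with `gl_k`. The product `C B` is
built from this `gl_2`, so it is `gl_k`-invariant, and it preserves both degrees because its terms
have weight zero. Its exchange relation is a telescoping sum (`GL2.genB_relation`), and its
normalization is the Chu–Vandermonde identity combined with the functional equation of the Gamma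
function (`cval_mul_sum`). Conversely, the operators in the defining relations generate everything
from the vectors `x_1^l ⊗ x_1^m` (`eq_top_of_relation`), so the `R`-matrix is unique and equals `C
B`.

The factors `C` are functions of the Cartan operators and commute with everything of weight zero.
Hence they can be moved through `X_i` and paired with the factors `B`, which matches `N_i X_i` with
`K_i` (`NN_mul_XX`, `opK_KK`). The second column of the theorem is the first one with the roles of
`k` and `n` exchanged (`SimOn.swap`). -/

noncomputable section

namespace KZDuality

/-! ### Functions of diagonalizable operators -/

section Abstract

variable {M M' : Type} [AddCommGroup M] [Module ℂ M] [AddCommGroup M'] [Module ℂ M']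

/-- The eigenvectors of `A` span the space. -/
def EigSpan (A : Module.End ℂ M) : Prop :=
  Submodule.span ℂ {v : M | ∃ μ : ℂ, A v = μ • v} = ⊤

/-- Choose a basis of eigenvectors and scale each one. An eigenvector for `μ` has nonzero
coordinates only at basis vectors of eigenvalue `μ`, so the prescription holds for all eigenvectors
and not just for the basis. -/
theorem exists_opFun {A : Module.End ℂ M} (hA : EigSpan A) (f : ℂ → ℂ) :
    ∃ T : Module.End ℂ M, ∀ (μ : ℂ) (v : M), A v = μ • v → T v = f μ • v := by
  classical
  let b := Module.Basis.ofSpan (K := ℂ) (s := {v : M | ∃ μ : ℂ, A v = μ • v}) hA.ge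
  have hb : ∀ i, ∃ μ : ℂ, A (b i) = μ • b i := fun i =>
    Module.Basis.ofSpan_subset (K := ℂ) hA.ge ⟨i, rfl⟩
  choose c hc using hb
  let T : Module.End ℂ M := b.constr ℂ fun i => f (c i) • b i
  have hT : ∀ i, T (b i) = f (c i) • b i := fun i => b.constr_basis ℂ _ i
  have reprA : ∀ v i, b.repr (A v) i = c i * b.repr v i := by
    intro v i
    have : (b.coord i) ∘ₗ A = c i • b.coord i := by
      refine b.ext fun j => ?_
      by_cases hij : j = i
      · subst hij; simp [hc]
      · simp [hc, hij]
    exact LinearMap.congr_fun this v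
  have reprT : ∀ v i, b.repr (T v) i = f (c i) * b.repr v i := by
    intro v i
    have : (b.coord i) ∘ₗ T = f (c i) • b.coord i := by
      refine b.ext fun j => ?_
      by_cases hij : j = i
      · subst hij; simp [hT]
      · simp [hT, hij]
    exact LinearMap.congr_fun this v
  refine ⟨T, fun μ v hv => b.repr.injective (Finsupp.ext fun i => ?_)⟩
  have h := reprA v i
  rw [hv, map_smul, Finsupp.smul_apply, smul_eq_mul] at h
  rw [reprT, map_smul, Finsupp.smul_apply, smul_eq_mul]
  by_cases h0 : b.repr v i = 0
  · simp [h0]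
  · rw [mul_right_cancel₀ h0 h]

theorem opFun_apply {A : Module.End ℂ M} (hA : EigSpan A) (f : ℂ → ℂ) {μ : ℂ} {v : M}
    (hv : A v = μ • v) : opFun f A v = f μ • v := by
  have h := exists_opFun hA f
  rw [opFun, dif_pos h]
  exact h.choose_spec μ v hv

theorem EigSpan.ext {A : Module.End ℂ M} (hA : EigSpan A) {S T : M →ₗ[ℂ] M'}
    (h : ∀ (μ : ℂ) (v : M), A v = μ • v → S v = T v) : S = T := by
  refine LinearMap.ext_on hA ?_
  rintro v ⟨μ, hv⟩
  exact h μ v hv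

/-- An intertwiner sends eigenvectors to eigenvectors with the same eigenvalue (or to zero), so it
respects functional calculus. -/
theorem opFun_intertwine {A : Module.End ℂ M} {A' : Module.End ℂ M'} (hA : EigSpan A)
    (hA' : EigSpan A') (f : ℂ → ℂ) {Φ : M →ₗ[ℂ] M'} (h : ∀ v, Φ (A v) = A' (Φ v)) (v : M) :
    Φ (opFun f A v) = opFun f A' (Φ v) := by
  refine LinearMap.congr_fun (hA.ext (S := Φ ∘ₗ opFun f A) (T := opFun f A' ∘ₗ Φ) ?_) v
  intro μ w hw
  have hw' : A' (Φ w) = μ • Φ w := by rw [← h, hw, map_smul]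
  simp [opFun_apply hA f hw, opFun_apply hA' f hw']

/-- The inverse is `μ ↦ μ⁻¹` applied to `A`; the convention `0⁻¹ = 0` is harmless because
injectivity leaves no nonzero eigenvector for `μ = 0`. -/
theorem isUnit_of_eigSpan {A : Module.End ℂ M} (hA : EigSpan A)
    (h0 : ∀ v, A v = 0 → v = 0) : IsUnit A := by
  have hne : ∀ (μ : ℂ) (v : M), A v = μ • v → (μ * μ⁻¹) • v = v := by
    intro μ v hv
    by_cases hμ : μ = 0
    · rw [h0 v (by rw [hv, hμ, zero_smul]), smul_zero]
    · rw [mul_inv_cancel₀ hμ, one_smul]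
  have h1 : A * opFun (fun μ => μ⁻¹) A = 1 := hA.ext fun μ v hv => by
    rw [Module.End.mul_apply, opFun_apply hA _ hv, map_smul, hv, smul_smul, mul_comm, hne μ v hv,
      Module.End.one_apply]
  have h2 : opFun (fun μ => μ⁻¹) A * A = 1 := hA.ext fun μ v hv => by
    rw [Module.End.mul_apply, hv, map_smul, opFun_apply hA _ hv, smul_smul, hne μ v hv,
      Module.End.one_apply]
  exact ⟨⟨A, _, h1, h2⟩, rfl⟩

theorem inverse_apply {A : Module.End ℂ M} (hA : IsUnit A) {μ : ℂ} (hμ : μ ≠ 0) {v : M}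
    (hv : A v = μ • v) : Ring.inverse A v = μ⁻¹ • v := by
  have h := LinearMap.congr_fun (Ring.inverse_mul_cancel A hA) v
  rw [Module.End.mul_apply, hv, map_smul, Module.End.one_apply] at h
  rw [← h, smul_smul, inv_mul_cancel₀ hμ, one_smul, h]

theorem opSeries_apply {A : ℕ → Module.End ℂ M}
    (hA : ∀ v : M, (Function.support fun s => A s v).Finite) (v : M) :
    opSeries A v = ∑ᶠ s, A s v := by
  rw [opSeries, dif_pos hA]; rfl

/-! ### Pairs of commuting number operators and `gl_2`-triples -/

/-- `v` has weight `(l, m)`. -/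
def HasWt (H₁ H₂ : Module.End ℂ M) (l m : ℕ) (v : M) : Prop :=
  H₁ v = (l : ℂ) • v ∧ H₂ v = (m : ℂ) • v

/-- The space is spanned by vectors whose weights are pairs of natural numbers. -/
def WtSpan (H₁ H₂ : Module.End ℂ M) : Prop :=
  Submodule.span ℂ {v : M | ∃ l m : ℕ, HasWt H₁ H₂ l m v} = ⊤

variable {E F H₁ H₂ : Module.End ℂ M} {E' F' H₁' H₂' : Module.End ℂ M'}

theorem WtSpan.ext (h : WtSpan H₁ H₂) {S T : M →ₗ[ℂ] M'}
    (hST : ∀ (l m : ℕ) (v : M), HasWt H₁ H₂ l m v → S v = T v) : S = T := by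
  refine LinearMap.ext_on h ?_
  rintro v ⟨l, m, hv⟩
  exact hST l m v hv

theorem WtSpan.eigSpan (h : WtSpan H₁ H₂) {A : Module.End ℂ M} {c : ℕ → ℕ → ℂ}
    (hA : ∀ (l m : ℕ) (v : M), HasWt H₁ H₂ l m v → A v = c l m • v) : EigSpan A := by
  refine top_le_iff.1 (h.ge.trans (Submodule.span_mono ?_))
  rintro v ⟨l, m, hv⟩
  exact ⟨c l m, hA l m v hv⟩

theorem WtSpan.eigSpan_left (h : WtSpan H₁ H₂) : EigSpan H₁ :=
  h.eigSpan (c := fun l _ => l) fun _ _ _ hv => hv.1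

theorem WtSpan.eigSpan_right (h : WtSpan H₁ H₂) : EigSpan H₂ :=
  h.eigSpan (c := fun _ m => m) fun _ _ _ hv => hv.2

theorem WtSpan.eigSpan_sub (h : WtSpan H₁ H₂) : EigSpan (H₁ - H₂) :=
  h.eigSpan (c := fun l m => (l : ℂ) - m) fun l m v hv => by
    rw [LinearMap.sub_apply, hv.1, hv.2, sub_smul]

/-- Only natural numbers are eigenvalues of `H₂`. -/
theorem WtSpan.eq_zero_of_right (h : WtSpan H₁ H₂) {v : M} {c : ℂ} (hc : ∀ m : ℕ, c ≠ m)
    (hv : H₂ v = c • v) : v = 0 := by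
  classical
  have hE := h.eigSpan_right
  -- The spectral projector at `c` kills the spanning weight vectors, yet it fixes `v`.
  have h0 : opFun (fun μ => if μ = c then 1 else 0) H₂ = 0 := h.ext fun l m w hw => by
    rw [opFun_apply hE _ hw.2, if_neg (hc m).symm, zero_smul, LinearMap.zero_apply]
  have h1 := opFun_apply hE (fun μ => if μ = c then 1 else 0) hv
  rw [h0, if_pos rfl, one_smul, LinearMap.zero_apply] at h1
  exact h1.symm

/-- The difference `H₁ - H₂` has only integer eigenvalues. -/
theorem WtSpan.eq_zero_of_sub (h : WtSpan H₁ H₂) {v : M} {c : ℂ} (hc : ∀ s : ℤ, c ≠ s)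
    (hv : (H₁ - H₂) v = c • v) : v = 0 := by
  classical
  have hE := h.eigSpan_sub
  have h0 : opFun (fun μ => if μ = c then 1 else 0) (H₁ - H₂) = 0 := h.ext fun l m w hw => by
    have hw' : (H₁ - H₂) w = ((l : ℂ) - m) • w := by
      rw [LinearMap.sub_apply, hw.1, hw.2, sub_smul]
    rw [opFun_apply hE _ hw', if_neg, zero_smul, LinearMap.zero_apply]
    intro hh
    exact hc (l - m) (by rw [← hh]; push_cast; rfl)
  have h1 := opFun_apply hE (fun μ => if μ = c then 1 else 0) hv
  rw [h0, if_pos rfl, one_smul, LinearMap.zero_apply] at h1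
  exact h1.symm

/-- The operator `Γ(t + 1) Γ(t - H₁ + H₂) / (Γ(t - H₁) Γ(t + H₂ + 1))`. -/
def genC (H₁ H₂ : Module.End ℂ M) (t : ℂ) : Module.End ℂ M :=
  Complex.Gamma (t + 1) •
    (opFun (fun μ => Complex.Gamma (t - μ)) (H₁ - H₂) *
      opFun (fun μ => (Complex.Gamma (t - μ))⁻¹) H₁ *
      opFun (fun μ => (Complex.Gamma (t + μ + 1))⁻¹) H₂)

/-- The value of `genC` on vectors of weight `(l, m)`. -/
def cval (t : ℂ) (l m : ℕ) : ℂ :=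
  Complex.Gamma (t + 1) * (Complex.Gamma (t - (l - m)) * (Complex.Gamma (t - l))⁻¹ *
    (Complex.Gamma (t + m + 1))⁻¹)

theorem genC_apply (h : WtSpan H₁ H₂) (t : ℂ) {l m : ℕ} {v : M} (hv : HasWt H₁ H₂ l m v) :
    genC H₁ H₂ t v = cval t l m • v := by
  have hw' : (H₁ - H₂) v = ((l : ℂ) - m) • v := by
    rw [LinearMap.sub_apply, hv.1, hv.2, sub_smul]
  rw [genC, LinearMap.smul_apply, Module.End.mul_apply, Module.End.mul_apply,
    opFun_apply h.eigSpan_right _ hv.2, map_smul, opFun_apply h.eigSpan_left _ hv.1, map_smul,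
    map_smul, opFun_apply h.eigSpan_sub _ hw', smul_smul, smul_smul, smul_smul, cval]
  congr 1
  ring

theorem genC_intertwine (h : WtSpan H₁ H₂) (h' : WtSpan H₁' H₂') (t : ℂ) {Φ : M →ₗ[ℂ] M'}
    (h1 : ∀ v, Φ (H₁ v) = H₁' (Φ v)) (h2 : ∀ v, Φ (H₂ v) = H₂' (Φ v)) (v : M) :
    Φ (genC H₁ H₂ t v) = genC H₁' H₂' t (Φ v) := by
  simp only [genC, LinearMap.smul_apply, Module.End.mul_apply, map_smul]
  rw [opFun_intertwine h.eigSpan_sub h'.eigSpan_sub _ (by simp [h1, h2]),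
    opFun_intertwine h.eigSpan_left h'.eigSpan_left _ h1,
    opFun_intertwine h.eigSpan_right h'.eigSpan_right _ h2]

/-- The relations of `e₁₂`, `e₂₁`, `e₁₁`, `e₂₂` in a module spanned by vectors whose weights are
pairs of natural numbers. -/
structure GL2 (E F H₁ H₂ : Module.End ℂ M) : Prop where
  EF : E * F = F * E + (H₁ - H₂)
  H₁E : H₁ * E = E * H₁ + E
  H₂E : H₂ * E = E * H₂ - E
  H₁F : H₁ * F = F * H₁ - F
  H₂F : H₂ * F = F * H₂ + F
  span : WtSpan H₁ H₂

/-- The series `1 + ∑_{s ≥ 1} F^s E^s ∏_{j=1}^s 1 / (j (t - H₁ + H₂ - j))`. -/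
def genB (E F H₁ H₂ : Module.End ℂ M) (t : ℂ) : Module.End ℂ M :=
  opSeries fun s => F ^ s * E ^ s *
    ((List.range s).map fun j : ℕ =>
      Ring.inverse (((j : ℂ) + 1) • ((t - ((j : ℂ) + 1)) • 1 - H₁ + H₂) :
        Module.End ℂ M)).prod

/-- The number `∏_{j=1}^s 1 / (j (t - h - j))`. -/
def bco (t h : ℂ) (s : ℕ) : ℂ :=
  ∏ j ∈ Finset.range s, (((j : ℂ) + 1) * (t - ((j : ℂ) + 1) - h))⁻¹

/-- This recursion for the coefficients is what makes the sum in `GL2.genB_relation` telescope. -/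
theorem bco_succ (t h : ℂ) (s : ℕ) (ht : t - ((s : ℂ) + 1) - h ≠ 0) :
    ((s : ℂ) + 1) * (t - ((s : ℂ) + 1) - h) * bco t h (s + 1) = bco t h s := by
  have hs : (s : ℂ) + 1 ≠ 0 := Nat.cast_add_one_ne_zero s
  rw [bco, Finset.prod_range_succ, bco]
  field_simp

/-- `H₁ - H₂` has only integer eigenvalues, whereas a kernel vector would have the non-integral
eigenvalue `t - (j + 1)`. -/
theorem factor_isUnit (h : WtSpan H₁ H₂) {t : ℂ} (ht : ∀ s : ℤ, t ≠ s) (j : ℕ) :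
    IsUnit (((j : ℂ) + 1) • ((t - ((j : ℂ) + 1)) • 1 - H₁ + H₂) : Module.End ℂ M) := by
  have hj : (j : ℂ) + 1 ≠ 0 := Nat.cast_add_one_ne_zero j
  refine isUnit_of_eigSpan (h.eigSpan
    (c := fun l m => ((j : ℂ) + 1) * (t - ((j : ℂ) + 1) - l + m)) fun l m v hv => ?_) fun v hv => ?_
  · simp only [LinearMap.smul_apply, LinearMap.add_apply, LinearMap.sub_apply, Module.End.one_apply,
      hv.1, hv.2]
    module
  · refine h.eq_zero_of_sub (c := t - ((j : ℂ) + 1)) (fun s hs => ht (s + (j + 1)) ?_) ?_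
    · push_cast
      rw [← hs]; ring
    · rw [LinearMap.smul_apply] at hv
      have := (smul_eq_zero.1 hv).resolve_left hj
      simp only [LinearMap.add_apply, LinearMap.sub_apply, LinearMap.smul_apply,
        Module.End.one_apply] at this ⊢
      rw [← sub_eq_zero, ← neg_eq_zero, ← this]
      abel

theorem factors_apply (h : WtSpan H₁ H₂) {t : ℂ} (ht : ∀ s : ℤ, t ≠ s) {l m : ℕ} {v : M}
    (hv : HasWt H₁ H₂ l m v) (s : ℕ) :
    ((List.range s).map fun j : ℕ =>
      Ring.inverse (((j : ℂ) + 1) • ((t - ((j : ℂ) + 1)) • 1 - H₁ + H₂) :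
        Module.End ℂ M)).prod v = bco t (l - m) s • v := by
  induction s with
  | zero => simp [bco]
  | succ s ih =>
    have hne : ((s : ℂ) + 1) * (t - ((s : ℂ) + 1) - (l - m)) ≠ 0 := by
      refine mul_ne_zero (Nat.cast_add_one_ne_zero s) fun h0 => ht (s + 1 + (l - m)) ?_
      push_cast
      linear_combination h0
    rw [List.range_succ, List.map_append, List.prod_append, List.map_singleton,
      List.prod_singleton, Module.End.mul_apply,
      inverse_apply (factor_isUnit h ht s) hne (v := v), map_smul, ih, smul_smul, bco, bco,
      Finset.prod_range_succ, mul_comm]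
    simp only [LinearMap.smul_apply, LinearMap.add_apply, LinearMap.sub_apply, Module.End.one_apply,
      hv.1, hv.2]
    module

theorem GL2.pow_E_H₂ (h : GL2 E F H₁ H₂) (s : ℕ) :
    H₂ * E ^ s = E ^ s * H₂ - (s : ℂ) • E ^ s := by
  induction s with
  | zero => simp
  | succ s ih =>
    rw [pow_succ', ← mul_assoc, h.H₂E, sub_mul, mul_assoc, ih]
    simp only [mul_sub, mul_smul_comm, mul_assoc]
    push_cast
    module

/-- `E^s` lowers the second weight to `m - s`, which is negative and hence not a weight. -/
theorem GL2.pow_E_apply (h : GL2 E F H₁ H₂) {l m : ℕ} {v : M} (hv : HasWt H₁ H₂ l m v) {s : ℕ}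
    (hs : m < s) : (E ^ s) v = 0 := by
  refine h.span.eq_zero_of_right (c := (m : ℂ) - s) (fun r hr => ?_) ?_
  · have : (m : ℂ) = ((r + s : ℕ) : ℂ) := by push_cast; rw [← hr]; ring
    have := Nat.cast_injective this
    omega
  · rw [← Module.End.mul_apply, h.pow_E_H₂, LinearMap.sub_apply, Module.End.mul_apply, hv.2,
      map_smul, LinearMap.smul_apply, sub_smul]

theorem GL2.term_apply (h : GL2 E F H₁ H₂) {t : ℂ} (ht : ∀ s : ℤ, t ≠ s) {l m : ℕ} {v : M}
    (hv : HasWt H₁ H₂ l m v) (s : ℕ) :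
    (F ^ s * E ^ s * ((List.range s).map fun j : ℕ =>
      Ring.inverse (((j : ℂ) + 1) • ((t - ((j : ℂ) + 1)) • 1 - H₁ + H₂) :
        Module.End ℂ M)).prod) v = bco t (l - m) s • (F ^ s * E ^ s) v := by
  rw [Module.End.mul_apply, factors_apply h.span ht hv, map_smul]

theorem GL2.finite_support (h : GL2 E F H₁ H₂) {t : ℂ} (ht : ∀ s : ℤ, t ≠ s) (v : M) :
    (Function.support fun s => (F ^ s * E ^ s * ((List.range s).map fun j : ℕ =>
      Ring.inverse (((j : ℂ) + 1) • ((t - ((j : ℂ) + 1)) • 1 - H₁ + H₂) :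
        Module.End ℂ M)).prod) v).Finite := by
  have hv : v ∈ Submodule.span ℂ {v : M | ∃ l m : ℕ, HasWt H₁ H₂ l m v} := by
    rw [h.span]; trivial
  induction hv using Submodule.span_induction with
  | mem v hv =>
    obtain ⟨l, m, hv⟩ := hv
    refine (Finset.range (m + 1)).finite_toSet.subset fun s hs => ?_
    by_contra hlt
    refine hs ?_
    have hms : m < s := by simpa [Nat.lt_succ_iff] using hlt
    simp only [h.term_apply ht hv, Module.End.mul_apply, h.pow_E_apply hv hms, map_zero, smul_zero]
  | zero => simp
  | add v w _ _ hv hw =>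
    refine (hv.union hw).subset ?_
    simp only [map_add]
    exact Function.support_add _ _
  | smul c v _ hv =>
    refine hv.subset ?_
    simp only [map_smul]
    exact Function.support_const_smul_subset c _

/-- The cut-off `N` is left free above `m` so that several series can be truncated at a common
length. -/
theorem GL2.genB_apply (h : GL2 E F H₁ H₂) {t : ℂ} (ht : ∀ s : ℤ, t ≠ s) {l m : ℕ} {v : M}
    (hv : HasWt H₁ H₂ l m v) {N : ℕ} (hN : m < N) :
    genB E F H₁ H₂ t v = ∑ s ∈ Finset.range N, bco t (l - m) s • (F ^ s * E ^ s) v := by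
  rw [genB, opSeries_apply (h.finite_support ht), finsum_eq_sum_of_support_subset (s := Finset.range N)]
  · exact Finset.sum_congr rfl fun s _ => h.term_apply ht hv s
  · intro s hs
    by_contra hlt
    refine hs ?_
    have hms : m < s := by
      simp only [Finset.coe_range, Set.mem_Iio, not_lt] at hlt
      omega
    simp only [h.term_apply ht hv, Module.End.mul_apply, h.pow_E_apply hv hms, map_zero, smul_zero]

/-- The coefficients depend only on the weight, which an intertwiner of the four operators
preserves; the truncated sums then agree term by term. -/
theorem genB_intertwine (h : GL2 E F H₁ H₂) (h' : GL2 E' F' H₁' H₂') {t : ℂ}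
    (ht : ∀ s : ℤ, t ≠ s) {Φ : M →ₗ[ℂ] M'}
    (hE : ∀ v, Φ (E v) = E' (Φ v)) (hF : ∀ v, Φ (F v) = F' (Φ v))
    (h1 : ∀ v, Φ (H₁ v) = H₁' (Φ v)) (h2 : ∀ v, Φ (H₂ v) = H₂' (Φ v)) (v : M) :
    Φ (genB E F H₁ H₂ t v) = genB E' F' H₁' H₂' t (Φ v) := by
  refine LinearMap.congr_fun (h.span.ext (S := Φ ∘ₗ genB E F H₁ H₂ t)
    (T := genB E' F' H₁' H₂' t ∘ₗ Φ) ?_) v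
  intro l m w hw
  have hw' : HasWt H₁' H₂' l m (Φ w) :=
    ⟨by rw [← h1, hw.1, map_smul], by rw [← h2, hw.2, map_smul]⟩
  have hEs : ∀ s v, Φ ((E ^ s) v) = (E' ^ s) (Φ v) := by
    intro s
    induction s with
    | zero => simp
    | succ s ih => intro v; rw [pow_succ, pow_succ, Module.End.mul_apply, ih, hE]; rfl
  have hFs : ∀ s v, Φ ((F ^ s) v) = (F' ^ s) (Φ v) := by
    intro s
    induction s with
    | zero => simp
    | succ s ih => intro v; rw [pow_succ, pow_succ, Module.End.mul_apply, ih, hF]; rfl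
  rw [LinearMap.comp_apply, LinearMap.comp_apply, h.genB_apply ht hw m.lt_succ_self,
    h'.genB_apply ht hw' m.lt_succ_self, map_sum]
  refine Finset.sum_congr rfl fun s _ => ?_
  rw [map_smul, Module.End.mul_apply, hFs, hEs]; rfl

theorem GL2.genB_hasWt (h : GL2 E F H₁ H₂) {t : ℂ} (ht : ∀ s : ℤ, t ≠ s) {l m : ℕ} {v : M}
    (hv : HasWt H₁ H₂ l m v) : HasWt H₁ H₂ l m (genB E F H₁ H₂ t v) := by
  -- The shifts `s c` and `-s c` produced by `F^s` and `E^s` cancel, so each `F^s E^s` has weight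
  -- zero. The constant is `c = -1` for `H₁` and `c = 1` for `H₂`.
  have key : ∀ (H : Module.End ℂ M) (c : ℂ), H * F = F * H + c • F → H * E = E * H - c • E →
      ∀ s, H * (F ^ s * E ^ s) = F ^ s * E ^ s * H := by
    intro H c hF hE s
    have hFs : H * F ^ s = F ^ s * H + (s * c) • F ^ s := by
      induction s with
      | zero => simp
      | succ s ih =>
        rw [pow_succ, ← mul_assoc, ih, add_mul, mul_assoc, hF]
        simp only [mul_add, mul_smul_comm, smul_mul_assoc, mul_assoc]
        push_cast
        module
    have hEs : H * E ^ s = E ^ s * H - (s * c) • E ^ s := by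
      clear hFs
      induction s with
      | zero => simp
      | succ s ih =>
        rw [pow_succ, ← mul_assoc, ih, sub_mul, mul_assoc, hE]
        simp only [mul_sub, mul_smul_comm, smul_mul_assoc, mul_assoc]
        push_cast
        module
    rw [← mul_assoc, hFs, add_mul, mul_assoc, hEs]
    simp only [mul_sub, mul_smul_comm, smul_mul_assoc, mul_assoc]
    module
  have k1 := key H₁ (-1) (by rw [h.H₁F]; module) (by rw [h.H₁E]; module)
  have k2 := key H₂ 1 (by rw [h.H₂F]; module) (by rw [h.H₂E]; module)
  rw [h.genB_apply ht hv m.lt_succ_self]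
  constructor
  · rw [map_sum, Finset.smul_sum]
    refine Finset.sum_congr rfl fun s _ => ?_
    rw [map_smul, ← Module.End.mul_apply, k1, Module.End.mul_apply, hv.1, map_smul, smul_comm]
  · rw [map_sum, Finset.smul_sum]
    refine Finset.sum_congr rfl fun s _ => ?_
    rw [map_smul, ← Module.End.mul_apply, k2, Module.End.mul_apply, hv.2, map_smul, smul_comm]

end Abstract

/-! ### Two commuting families of Weyl algebra generators -/

section Doublet

variable {M : Type} [AddCommGroup M] [Module ℂ M] {E F H K X Y P Q : Module.End ℂ M}

theorem GL2.H_E_pow_apply (G : GL2 E F H K) {μ : ℂ} {w : M} (hw : (H - K) w = μ • w) (s : ℕ) :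
    (H - K) ((E ^ s) w) = (μ + 2 * s) • (E ^ s) w := by
  have hE : (H - K) * E = E * (H - K) + (2 : ℂ) • E := by
    rw [sub_mul, G.H₁E, G.H₂E, mul_sub, two_smul]; abel
  induction s with
  | zero => simpa using hw
  | succ s ih =>
    rw [pow_succ', Module.End.mul_apply, ← Module.End.mul_apply, hE, LinearMap.add_apply,
      Module.End.mul_apply, ih, map_smul, LinearMap.smul_apply, ← add_smul]
    push_cast
    ring_nf

theorem GL2.H_F_pow_apply (G : GL2 E F H K) {μ : ℂ} {w : M} (hw : (H - K) w = μ • w) (s : ℕ) :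
    (H - K) ((F ^ s) w) = (μ - 2 * s) • (F ^ s) w := by
  have hF : (H - K) * F = F * (H - K) - (2 : ℂ) • F := by
    rw [sub_mul, G.H₁F, G.H₂F, mul_sub, two_smul]; abel
  induction s with
  | zero => simpa using hw
  | succ s ih =>
    rw [pow_succ', Module.End.mul_apply, ← Module.End.mul_apply, hF, LinearMap.sub_apply,
      Module.End.mul_apply, ih, map_smul, LinearMap.smul_apply, ← sub_smul]
    push_cast
    ring_nf

theorem GL2.EF_apply (G : GL2 E F H K) (w : M) : E (F w) = F (E w) + (H - K) w :=
  LinearMap.congr_fun G.EF w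

/-- Moving `E` through `F^(s+1)` collects the weights `μ, μ - 2, …, μ - 2s`, whose sum is `(s + 1)(μ
- s)`. -/
theorem GL2.E_F_pow_apply (G : GL2 E F H K) {μ : ℂ} {w : M} (hw : (H - K) w = μ • w) (s : ℕ) :
    E ((F ^ (s + 1)) w) = (F ^ (s + 1)) (E w) + (((s : ℂ) + 1) * (μ - s)) • (F ^ s) w := by
  induction s with
  | zero => simp [G.EF_apply w, hw]
  | succ s ih =>
    rw [pow_succ', Module.End.mul_apply, G.EF_apply, ih, G.H_F_pow_apply hw, map_add, map_smul,
      Module.End.mul_apply, ← Module.End.mul_apply F (F ^ s), ← pow_succ']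
    push_cast
    module

theorem GL2.E_pow_F_apply (G : GL2 E F H K) {μ : ℂ} {w : M} (hw : (H - K) w = μ • w) (s : ℕ) :
    (E ^ (s + 1)) (F w) = F ((E ^ (s + 1)) w) + (((s : ℂ) + 1) * (μ + s)) • (E ^ s) w := by
  induction s with
  | zero => simp [G.EF_apply w, hw]
  | succ s ih =>
    rw [pow_succ', Module.End.mul_apply, ih, map_add, map_smul, G.EF_apply, G.H_E_pow_apply hw,
      Module.End.mul_apply, ← Module.End.mul_apply E (E ^ s), ← pow_succ']
    push_cast
    module

/-- The series `B` intertwines the two sides of the defining relation of the `R`-matrix; here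
`(X, Y)` and `(P, Q)` are doublets of tensor operators. -/
theorem GL2.genB_relation (G : GL2 E F H K) (EX : E * X = X * E) (FX : F * X = X * F + Y)
    (FY : F * Y = Y * F) (PE : P * E = E * P + Q) (QE : Q * E = E * Q) (PF : P * F = F * P)
    (PH : P * H = H * P + P) (PK : P * K = K * P) (QH : Q * H = H * Q) (QK : Q * K = K * Q + Q)
    {t : ℂ} (ht : ∀ s : ℤ, t ≠ s) {l m : ℕ} {v : M} (hv : HasWt H K l m v)
    (hL : HasWt H K l m ((t • (X * P) + X * F * Q) v)) :
    genB E F H K t ((t • (X * P) + X * F * Q) v) =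
      (t • (X * P) + Y * E * P) (genB E F H K t v) := by
  have hEX : ∀ s w, (E ^ s) (X w) = X ((E ^ s) w) := fun s w =>
    LinearMap.congr_fun ((show Commute E X from EX).pow_left s) w
  have hFY : ∀ s w, (F ^ s) (Y w) = Y ((F ^ s) w) := fun s w =>
    LinearMap.congr_fun ((show Commute F Y from FY).pow_left s) w
  have hQE : ∀ s w, Q ((E ^ s) w) = (E ^ s) (Q w) := fun s w =>
    LinearMap.congr_fun ((show Commute Q E from QE).pow_right s) w
  have hPF : ∀ s w, P ((F ^ s) w) = (F ^ s) (P w) := fun s w =>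
    LinearMap.congr_fun ((show Commute P F from PF).pow_right s) w
  have hFX : ∀ (s : ℕ) w, (F ^ (s + 1)) (X w) =
      X ((F ^ (s + 1)) w) + ((s : ℂ) + 1) • Y ((F ^ s) w) := by
    intro s
    induction s with
    | zero => intro w; simpa using LinearMap.congr_fun FX w
    | succ s ih =>
      intro w
      have h1 := LinearMap.congr_fun FX w
      simp only [Module.End.mul_apply, LinearMap.add_apply] at h1
      rw [pow_succ, Module.End.mul_apply, h1, map_add, ih, hFY, Module.End.mul_apply,
        ← Module.End.mul_apply (F ^ s), ← pow_succ]
      push_cast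
      module
  have hPE : ∀ (s : ℕ) w, P ((E ^ (s + 1)) w) =
      (E ^ (s + 1)) (P w) + ((s : ℂ) + 1) • (E ^ s) (Q w) := by
    intro s
    induction s with
    | zero => intro w; simpa using LinearMap.congr_fun PE w
    | succ s ih =>
      intro w
      have h1 := LinearMap.congr_fun PE ((E ^ (s + 1)) w)
      simp only [Module.End.mul_apply, LinearMap.add_apply] at h1
      rw [pow_succ', Module.End.mul_apply, h1, ih, map_add, map_smul, hQE, Module.End.mul_apply,
        ← Module.End.mul_apply E (E ^ s), ← pow_succ']
      push_cast
      module
  have hQv : (H - K) (Q v) = ((l : ℂ) - m + 1) • Q v := by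
    have h1 := LinearMap.congr_fun QH v
    have h2 := LinearMap.congr_fun QK v
    simp only [Module.End.mul_apply, LinearMap.add_apply, hv.1, hv.2, map_smul] at h1 h2
    rw [LinearMap.sub_apply, ← h1, eq_sub_of_add_eq h2.symm]
    module
  have hPv : (H - K) (P v) = ((l : ℂ) - m - 1) • P v := by
    have h1 := LinearMap.congr_fun PH v
    have h2 := LinearMap.congr_fun PK v
    simp only [Module.End.mul_apply, LinearMap.add_apply, hv.1, hv.2, map_smul] at h1 h2
    rw [LinearMap.sub_apply, ← h2, eq_sub_of_add_eq h1.symm]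
    module
  -- The boundary terms of the telescoping sum. By `TS`, the commutator defect of `F^(s+1) E^(s+1)`
  -- is `U (s + 1)` minus a multiple of `U s`, and that multiple is the factor by which `bco` drops
  -- from `s` to `s + 1`.
  let U : ℕ → M := fun s => X ((F ^ (s + 1)) ((E ^ s) (Q v))) - Y ((F ^ s) ((E ^ (s + 1)) (P v)))
  have T0 : (X * F * Q) v - (Y * E * P) v = U 0 := by simp [U]
  have TS : ∀ s : ℕ, (F ^ (s + 1) * E ^ (s + 1)) ((t • (X * P) + X * F * Q) v) -
      (t • (X * P) + Y * E * P) ((F ^ (s + 1) * E ^ (s + 1)) v) =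
      U (s + 1) - (((s : ℂ) + 1) * (t - ((s : ℂ) + 1) - (l - m))) • U s := by
    intro s
    have hEPv := G.H_E_pow_apply hPv (s + 1)
    have hEQv := G.H_E_pow_apply hQv s
    simp only [LinearMap.add_apply, LinearMap.smul_apply, Module.End.mul_apply, map_add, map_smul,
      hEX, hFX, hPF, hPE, G.E_pow_F_apply hQv, G.E_F_pow_apply hEPv, G.E_F_pow_apply hEQv]
    simp only [U, ← Module.End.mul_apply E (E ^ _), ← Module.End.mul_apply (F ^ _) F, ← pow_succ',
      ← pow_succ]
    push_cast
    module
  -- Both summands vanish since `E^(m+1)` and `E^(m+2)` annihilate `v`; the powers of `E` are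
  -- carried past `Q` and `P` by `hQE` and `hPE`.
  have UN : U (m + 1) = 0 := by
    have h1 : (E ^ (m + 1)) (Q v) = 0 := by
      rw [← hQE, G.pow_E_apply hv m.lt_succ_self, map_zero]
    have h2 : (E ^ (m + 1 + 1)) (P v) = 0 := by
      have := hPE (m + 1) v
      rwa [G.pow_E_apply hv (by omega), map_zero, h1, smul_zero, add_zero, eq_comm] at this
    simp only [U, h1, h2, map_zero, sub_zero]
  have main : ∀ N : ℕ, ∑ s ∈ Finset.range (N + 1), (bco t (l - m) s •
      ((F ^ s * E ^ s) ((t • (X * P) + X * F * Q) v) -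
        (t • (X * P) + Y * E * P) ((F ^ s * E ^ s) v))) = bco t (l - m) N • U N := by
    intro N
    induction N with
    | zero =>
      rw [Finset.sum_range_one, ← T0]
      simp
    | succ N ih =>
      have hne : t - ((N : ℂ) + 1) - (l - m) ≠ 0 := fun h0 => ht (N + 1 + (l - m)) (by
        push_cast
        linear_combination h0)
      rw [Finset.sum_range_succ, ih, TS, ← bco_succ _ _ _ hne]
      generalize U N = u, U (N + 1) = u'
      module
  have hm := main (m + 1)
  rw [UN, smul_zero] at hm
  -- Truncation at `m + 2` makes the last index `m + 1`, where the boundary term is zero. By `hL`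
  -- both series have the same coefficients.
  rw [G.genB_apply ht hL (N := m + 1 + 1) (by omega), G.genB_apply ht hv (N := m + 1 + 1) (by omega),
    map_sum, ← sub_eq_zero, ← Finset.sum_sub_distrib, ← hm]
  refine Finset.sum_congr rfl fun s _ => ?_
  rw [map_smul, smul_sub]

end Doublet

/-! ### The dual `gl_2` inside a Weyl algebra in two sets of variables. -/

section Weyl

theorem sum_mul_comm_of {R ι : Type} [Ring R] [Fintype ι] {u w : ι → R} {z : R}
    (hu : ∀ a, u a * z = z * u a) (hw : ∀ a, w a * z = z * w a) :
    (∑ a, u a * w a) * z = z * ∑ a, u a * w a := by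
  rw [Finset.sum_mul, Finset.mul_sum]
  refine Finset.sum_congr rfl fun a _ => ?_
  rw [mul_assoc, hw, ← mul_assoc, hu, mul_assoc]

theorem sum_mul_of_right {R ι : Type} [Ring R] [Fintype ι] [DecidableEq ι] {u w : ι → R} {z : R}
    {b : ι} (hu : ∀ a, u a * z = z * u a) (hw : ∀ a, w a * z = z * w a + if a = b then 1 else 0) :
    (∑ a, u a * w a) * z = z * (∑ a, u a * w a) + u b := by
  rw [Finset.sum_mul, Finset.mul_sum]
  have : u b = ∑ a, if a = b then u a else 0 := by simp
  rw [this, ← Finset.sum_add_distrib]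
  refine Finset.sum_congr rfl fun a _ => ?_
  rw [mul_assoc, hw, mul_add, ← mul_assoc, hu, mul_assoc]
  split_ifs <;> simp

theorem mul_sum_of_left {R ι : Type} [Ring R] [Fintype ι] [DecidableEq ι] {u w : ι → R} {z : R}
    {b : ι} (hu : ∀ a, z * u a = u a * z + if b = a then 1 else 0) (hw : ∀ a, w a * z = z * w a) :
    z * (∑ a, u a * w a) = (∑ a, u a * w a) * z + w b := by
  rw [Finset.sum_mul, Finset.mul_sum]
  have : w b = ∑ a, if b = a then w a else 0 := by simp
  rw [this, ← Finset.sum_add_distrib]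
  refine Finset.sum_congr rfl fun a _ => ?_
  rw [← mul_assoc, hu, add_mul, mul_assoc, ← hw, mul_assoc]
  split_ifs <;> simp

/-- The commutation relations of the variables `x_a`, `y_a` and of the derivatives `p_a`, `q_a` with
respect to them. -/
structure Weyl2 {R ι : Type} [Ring R] [DecidableEq ι] (x y p q : ι → R) : Prop where
  px : ∀ a b, p a * x b = x b * p a + if a = b then 1 else 0
  qy : ∀ a b, q a * y b = y b * q a + if a = b then 1 else 0
  py : ∀ a b, p a * y b = y b * p a
  qx : ∀ a b, q a * x b = x b * q a
  xx : ∀ a b, x a * x b = x b * x a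
  xy : ∀ a b, x a * y b = y b * x a
  yy : ∀ a b, y a * y b = y b * y a
  pp : ∀ a b, p a * p b = p b * p a
  pq : ∀ a b, p a * q b = q b * p a
  qq : ∀ a b, q a * q b = q b * q a

namespace Weyl2

theorem swap {R ι : Type} [Ring R] [DecidableEq ι] {x y p q : ι → R} (W : Weyl2 x y p q) : Weyl2 y x q p :=
  ⟨W.qy, W.px, W.qx, W.py, W.yy, fun a b => (W.xy b a).symm, W.xx, W.qq,
    fun a b => (W.pq b a).symm, W.pp⟩

variable {R ι : Type} [Ring R] [Fintype ι] [DecidableEq ι] {x y p q : ι → R}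

theorem Ex (W : Weyl2 x y p q) (b : ι) : (∑ a, x a * q a) * x b = x b * ∑ a, x a * q a :=
  sum_mul_comm_of (fun a => W.xx a b) fun a => W.qx a b

theorem Ey (W : Weyl2 x y p q) (b : ι) :
    (∑ a, x a * q a) * y b = y b * (∑ a, x a * q a) + x b :=
  sum_mul_of_right (fun a => W.xy a b) fun a => W.qy a b

theorem pE (W : Weyl2 x y p q) (b : ι) :
    p b * (∑ a, x a * q a) = (∑ a, x a * q a) * p b + q b :=
  mul_sum_of_left (fun a => W.px b a) fun a => (W.pq b a).symm

theorem qE (W : Weyl2 x y p q) (b : ι) : q b * (∑ a, x a * q a) = (∑ a, x a * q a) * q b :=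
  (sum_mul_comm_of (fun a => (W.qx b a).symm) fun a => W.qq a b).symm

theorem Hx (W : Weyl2 x y p q) (b : ι) : (∑ a, x a * p a) * x b = x b * (∑ a, x a * p a) + x b :=
  sum_mul_of_right (fun a => W.xx a b) fun a => W.px a b

theorem Hy (W : Weyl2 x y p q) (b : ι) : (∑ a, x a * p a) * y b = y b * ∑ a, x a * p a :=
  sum_mul_comm_of (fun a => W.xy a b) fun a => W.py a b

theorem pH (W : Weyl2 x y p q) (b : ι) : p b * (∑ a, x a * p a) = (∑ a, x a * p a) * p b + p b :=
  mul_sum_of_left (fun a => W.px b a) fun a => W.pp a b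

theorem qH (W : Weyl2 x y p q) (b : ι) : q b * (∑ a, x a * p a) = (∑ a, x a * p a) * q b :=
  (sum_mul_comm_of (fun a => (W.qx b a).symm) fun a => W.pq a b).symm

theorem EF (W : Weyl2 x y p q) : (∑ a, x a * q a) * (∑ a, y a * p a) =
    (∑ a, y a * p a) * (∑ a, x a * q a) + (∑ a, x a * p a - ∑ a, y a * q a) := by
  conv_lhs => rw [Finset.mul_sum]
  rw [Finset.sum_mul, ← Finset.sum_sub_distrib, ← Finset.sum_add_distrib]
  refine Finset.sum_congr rfl fun a _ => ?_
  rw [← mul_assoc, W.Ey, mul_assoc (y a) (p a), W.pE, mul_add, add_mul, mul_assoc]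
  abel

theorem H₁E (W : Weyl2 x y p q) : (∑ a, x a * p a) * (∑ a, x a * q a) =
    (∑ a, x a * q a) * (∑ a, x a * p a) + ∑ a, x a * q a := by
  conv_lhs => rw [Finset.mul_sum]
  rw [Finset.sum_mul (s := Finset.univ) (f := fun a => x a * q a), ← Finset.sum_add_distrib]
  refine Finset.sum_congr rfl fun a _ => ?_
  rw [← mul_assoc, W.Hx, mul_assoc (x a) (q a), W.qH, add_mul, mul_assoc]

theorem H₁F (W : Weyl2 x y p q) : (∑ a, x a * p a) * (∑ a, y a * p a) =
    (∑ a, y a * p a) * (∑ a, x a * p a) - ∑ a, y a * p a := by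
  conv_lhs => rw [Finset.mul_sum]
  rw [Finset.sum_mul (s := Finset.univ) (f := fun a => y a * p a), ← Finset.sum_sub_distrib]
  refine Finset.sum_congr rfl fun a _ => ?_
  rw [← mul_assoc, W.Hy, mul_assoc (y a) (p a), W.pH, mul_add, mul_assoc]
  abel

theorem invariant_comm (W : Weyl2 x y p q) (a b : ι) :
    (x a * p b + y a * q b) * (∑ c, x c * q c) = (∑ c, x c * q c) * (x a * p b + y a * q b) := by
  rw [add_mul, mul_add, mul_assoc, W.pE, ← mul_assoc (Finset.sum _ _) (x a), W.Ex,
    ← mul_assoc (Finset.sum _ _) (y a), W.Ey, mul_assoc (y a), W.qE]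
  noncomm_ring

theorem invariant_comm_H (W : Weyl2 x y p q) (a b : ι) :
    (x a * p b + y a * q b) * (∑ c, x c * p c) = (∑ c, x c * p c) * (x a * p b + y a * q b) := by
  rw [add_mul, mul_add, mul_assoc, W.pH, mul_assoc, W.qH, ← mul_assoc (Finset.sum _ _) (x a), W.Hx,
    ← mul_assoc (Finset.sum _ _) (y a), W.Hy]
  noncomm_ring

end Weyl2

/-- Exchanging the two sets of variables swaps `E` with `F` and `H₁` with `H₂`, so the relations for
`H₂` are those for `H₁` after `swap`. -/
theorem Weyl2.gl2 {M ι : Type} [AddCommGroup M] [Module ℂ M] [Fintype ι] [DecidableEq ι]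
    {x y p q : ι → Module.End ℂ M} (W : Weyl2 x y p q)
    (hs : WtSpan (∑ a, x a * p a) (∑ a, y a * q a)) :
    GL2 (∑ a, x a * q a) (∑ a, y a * p a) (∑ a, x a * p a) (∑ a, y a * q a) :=
  ⟨W.EF, W.H₁E, W.swap.H₁F, W.H₁F, W.swap.H₁E, hs⟩

theorem HasWt.map {M M' : Type} [AddCommGroup M] [Module ℂ M] [AddCommGroup M'] [Module ℂ M']
    {H K : Module.End ℂ M} {H' K' : Module.End ℂ M'} {Φ : M →ₗ[ℂ] M'}
    (h1 : ∀ v, Φ (H v) = H' (Φ v)) (h2 : ∀ v, Φ (K v) = K' (Φ v)) {l m : ℕ} {v : M}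
    (hv : HasWt H K l m v) : HasWt H' K' l m (Φ v) :=
  ⟨by rw [← h1, hv.1, map_smul], by rw [← h2, hv.2, map_smul]⟩

/-- Both sides of the relation for the `R`-matrix preserve weights. -/
theorem Weyl2.relation_left_comm {M ι : Type} [AddCommGroup M] [Module ℂ M] [Fintype ι]
    [DecidableEq ι] {x y p q : ι → Module.End ℂ M} (W : Weyl2 x y p q) (t : ℂ) (a b : ι) :
    Commute (t • (x a * p b) + x a * (∑ c, y c * p c) * q b) (∑ c, x c * p c) ∧
    Commute (t • (x a * p b) + x a * (∑ c, y c * p c) * q b) (∑ c, y c * q c) := by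
  have Hx := W.Hx a
  have Kx := W.swap.Hy a
  have pH := W.pH b
  have qK := W.swap.pH b
  have qH := W.qH b
  have pK := W.swap.qH b
  have HF := W.H₁F
  have KF := W.swap.H₁E
  generalize (∑ a, y a * p a) = F at *
  generalize (∑ a, x a * p a) = H at *
  generalize (∑ a, y a * q a) = K at *
  constructor
  · refine Commute.add_left (Commute.smul_left ?_ t) ?_
    · show _ = _
      rw [mul_assoc, pH, ← mul_assoc H, Hx]; noncomm_ring
    · show _ = _
      rw [mul_assoc, qH, ← mul_assoc H, ← mul_assoc H, Hx, add_mul, mul_assoc (x a) H, HF]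
      noncomm_ring
  · refine Commute.add_left (Commute.smul_left ?_ t) ?_
    · show _ = _
      rw [mul_assoc, pK, ← mul_assoc K, Kx]; noncomm_ring
    · show _ = _
      rw [mul_assoc, qK, ← mul_assoc K, ← mul_assoc K, Kx, mul_assoc (x a) K, KF]
      noncomm_ring

theorem Weyl2.relation_right_comm {M ι : Type} [AddCommGroup M] [Module ℂ M] [Fintype ι]
    [DecidableEq ι] {x y p q : ι → Module.End ℂ M} (W : Weyl2 x y p q) (t : ℂ) (a b : ι) :
    Commute (t • (x a * p b) + y a * (∑ c, x c * q c) * p b) (∑ c, x c * p c) ∧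
    Commute (t • (x a * p b) + y a * (∑ c, x c * q c) * p b) (∑ c, y c * q c) := by
  have Hx := W.Hx a
  have Kx := W.swap.Hy a
  have Ky := W.swap.Hx a
  have Hy := W.Hy a
  have pH := W.pH b
  have pK := W.swap.qH b
  have HE := W.H₁E
  have KE := W.swap.H₁F
  generalize (∑ a, x a * q a) = E at *
  generalize (∑ a, x a * p a) = H at *
  generalize (∑ a, y a * q a) = K at *
  constructor
  · refine Commute.add_left (Commute.smul_left ?_ t) ?_
    · show _ = _
      rw [mul_assoc, pH, ← mul_assoc H, Hx]; noncomm_ring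
    · show _ = _
      rw [mul_assoc, pH, ← mul_assoc H, ← mul_assoc H, Hy, mul_assoc _ H, HE]
      noncomm_ring
  · refine Commute.add_left (Commute.smul_left ?_ t) ?_
    · show _ = _
      rw [mul_assoc, pK, ← mul_assoc K, Kx]; noncomm_ring
    · show _ = _
      rw [mul_assoc, pK, ← mul_assoc K, ← mul_assoc K, Ky, add_mul, mul_assoc _ K, KE]
      noncomm_ring

/-- The doublets of the abstract relation are here the variables `(x_a, y_a)` and the derivatives
`(p_b, q_b)`. -/
theorem Weyl2.genB_relation {M ι : Type} [AddCommGroup M] [Module ℂ M] [Fintype ι] [DecidableEq ι]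
    {x y p q : ι → Module.End ℂ M} (W : Weyl2 x y p q)
    (hs : WtSpan (∑ a, x a * p a) (∑ a, y a * q a)) {t : ℂ} (ht : ∀ s : ℤ, t ≠ s) (a b : ι)
    {l m : ℕ} {v : M} (hv : HasWt (∑ a, x a * p a) (∑ a, y a * q a) l m v) :
    genB (∑ a, x a * q a) (∑ a, y a * p a) (∑ a, x a * p a) (∑ a, y a * q a) t
        ((t • (x a * p b) + x a * (∑ c, y c * p c) * q b) v) =
      (t • (x a * p b) + y a * (∑ c, x c * q c) * p b)
        (genB (∑ a, x a * q a) (∑ a, y a * p a) (∑ a, x a * p a) (∑ a, y a * q a) t v) := by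
  refine (W.gl2 hs).genB_relation (W.Ex a) (W.swap.Ey a) (W.swap.Ex a) (W.pE b) (W.qE b)
    (W.swap.qE b) (W.pH b) (W.swap.qH b) (W.qH b) (W.swap.pH b) ht hv ?_
  obtain ⟨c1, c2⟩ := W.relation_left_comm t a b
  exact hv.map (fun w => LinearMap.congr_fun c1 w) fun w => LinearMap.congr_fun c2 w

end Weyl

/-! ### The Weyl algebra acting on polynomials -/

/-- Multiplication by the variable `X_s`. -/
def mX {σ : Type} (s : σ) : Module.End ℂ (MvPolynomial σ ℂ) := LinearMap.mulLeft ℂ (MvPolynomial.X s)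

/-- The partial derivative with respect to the variable `X_s`. -/
def dX {σ : Type} (s : σ) : Module.End ℂ (MvPolynomial σ ℂ) :=
  (MvPolynomial.pderiv s : Derivation ℂ (MvPolynomial σ ℂ) (MvPolynomial σ ℂ))

section Poly

variable {σ : Type}

theorem mX_apply (s : σ) (p : MvPolynomial σ ℂ) : mX s p = MvPolynomial.X s * p := rfl

theorem dX_apply (s : σ) (p : MvPolynomial σ ℂ) : dX s p = MvPolynomial.pderiv s p := rfl

theorem mX_mul_mX (s r : σ) : mX s * mX r = mX r * mX s :=
  LinearMap.ext fun p => by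
    simp only [Module.End.mul_apply, mX_apply]; ring

theorem dX_mul_mX [DecidableEq σ] (s r : σ) :
    dX s * mX r = mX r * dX s + if s = r then 1 else 0 :=
  LinearMap.ext fun p => by
    simp only [Module.End.mul_apply, mX_apply, dX_apply, MvPolynomial.pderiv_mul,
      MvPolynomial.pderiv_X, LinearMap.add_apply]
    by_cases h : s = r
    · subst h; simp [add_comm]
    · simp [h, Ne.symm h]

/-- The commutator of two derivations is a derivation, and this one vanishes on the variables. -/
theorem dX_mul_dX (s r : σ) : dX s * dX r = dX r * dX s := by
  classical
  have : ⁅(MvPolynomial.pderiv s : Derivation ℂ (MvPolynomial σ ℂ) (MvPolynomial σ ℂ)),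
      (MvPolynomial.pderiv r : Derivation ℂ (MvPolynomial σ ℂ) (MvPolynomial σ ℂ))⁆ = 0 := by
    refine MvPolynomial.derivation_ext fun j => ?_
    rw [Derivation.commutator_apply, MvPolynomial.pderiv_X, MvPolynomial.pderiv_X]
    simp only [Pi.single_apply]
    split_ifs <;> simp
  refine LinearMap.ext fun p => ?_
  have h := congrArg (fun D : Derivation ℂ (MvPolynomial σ ℂ) (MvPolynomial σ ℂ) => D p) this
  simp only [Derivation.commutator_apply, Derivation.zero_apply] at h
  exact sub_eq_zero.1 h

theorem mX_mul_dX_monomial (s r : σ) (α : σ →₀ ℕ) :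
    (mX s * dX r) (MvPolynomial.monomial α 1) =
      (α r : ℂ) • MvPolynomial.monomial (α - Finsupp.single r 1 + Finsupp.single s 1) (1 : ℂ) := by
  rw [Module.End.mul_apply, dX_apply, mX_apply, MvPolynomial.pderiv_monomial, one_mul,
    MvPolynomial.X, MvPolynomial.monomial_mul, MvPolynomial.smul_monomial, add_comm]
  simp

theorem mX_mul_dX_self_monomial (s : σ) (α : σ →₀ ℕ) :
    (mX s * dX s) (MvPolynomial.monomial α 1) = (α s : ℂ) • MvPolynomial.monomial α (1 : ℂ) := by
  rw [mX_mul_dX_monomial]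
  by_cases h : α s = 0
  · simp [h]
  · rw [tsub_add_cancel_of_le]
    simpa [Nat.one_le_iff_ne_zero] using h

theorem span_monomial : Submodule.span ℂ
    (Set.range fun α : σ →₀ ℕ => (MvPolynomial.monomial α (1 : ℂ))) = ⊤ := by
  have := (MvPolynomial.basisMonomials σ ℂ).span_eq
  simpa [MvPolynomial.coe_basisMonomials] using this

end Poly

theorem e_eq {k : ℕ} (a b : Fin k) : e a b = mX a * dX b := rfl

/-! ### The tensor square of `𝕍` -/

section Square

variable {k : ℕ}

theorem tens_mul (f g f' g' : Module.End ℂ (VV k)) :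
    tens f g * tens f' g' = tens (f * f') (g * g') :=
  (TensorProduct.map_mul f f' g g').symm

theorem tens_left_ite (P : Prop) [Decidable P] (f : Module.End ℂ (VV k)) :
    tens (f + if P then 1 else 0) 1 = tens f 1 + if P then 1 else 0 := by
  rw [tens, TensorProduct.map_add_left]
  split_ifs
  · rw [TensorProduct.map_one]
  · rw [TensorProduct.map_zero_left]

theorem tens_right_ite (P : Prop) [Decidable P] (f : Module.End ℂ (VV k)) :
    tens 1 (f + if P then 1 else 0) = tens 1 f + if P then 1 else 0 := by
  rw [tens, TensorProduct.map_add_right]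
  split_ifs
  · rw [TensorProduct.map_one]
  · rw [TensorProduct.map_zero_right]

theorem weyl_square : Weyl2 (fun a : Fin k => tens (mX a) 1) (fun a => tens 1 (mX a))
    (fun a => tens (dX a) 1) (fun a => tens 1 (dX a)) where
  px a b := by simp only [tens_mul, one_mul, dX_mul_mX, tens_left_ite]
  qy a b := by simp only [tens_mul, one_mul, dX_mul_mX, tens_right_ite]
  py a b := by simp only [tens_mul, one_mul, mul_one]
  qx a b := by simp only [tens_mul, one_mul, mul_one]
  xx a b := by simp only [tens_mul, one_mul, mX_mul_mX a b]
  xy a b := by simp only [tens_mul, one_mul, mul_one]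
  yy a b := by simp only [tens_mul, one_mul, mX_mul_mX a b]
  pp a b := by simp only [tens_mul, one_mul, dX_mul_dX a b]
  pq a b := by simp only [tens_mul, one_mul, mul_one]
  qq a b := by simp only [tens_mul, one_mul, dX_mul_dX a b]

/-- The product of two monomials in the tensor square. -/
def mm (α β : Fin k →₀ ℕ) : VV k ⊗[ℂ] VV k :=
  MvPolynomial.monomial α (1 : ℂ) ⊗ₜ[ℂ] MvPolynomial.monomial β (1 : ℂ)

theorem span_mm : Submodule.span ℂ {v : VV k ⊗[ℂ] VV k | ∃ α β, v = mm α β} = ⊤ := by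
  have := TensorProduct.span_tmul_eq_top ℂ (VV k) (VV k)
  rw [eq_top_iff, ← this, Submodule.span_le]
  rintro _ ⟨p, q, rfl⟩
  have hp : p ∈ Submodule.span ℂ
    (Set.range fun α : Fin k →₀ ℕ => (MvPolynomial.monomial α (1 : ℂ))) := by
      rw [span_monomial]; trivial
  have hq : q ∈ Submodule.span ℂ
    (Set.range fun α : Fin k →₀ ℕ => (MvPolynomial.monomial α (1 : ℂ))) := by
      rw [span_monomial]; trivial
  induction hp using Submodule.span_induction with
  | mem p hp =>
    obtain ⟨α, rfl⟩ := hp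
    induction hq using Submodule.span_induction with
    | mem q hq => obtain ⟨β, rfl⟩ := hq; exact Submodule.subset_span ⟨α, β, rfl⟩
    | zero => simp
    | add x y _ _ hx hy => rw [TensorProduct.tmul_add]; exact add_mem hx hy
    | smul c x _ hx => rw [TensorProduct.tmul_smul]; exact Submodule.smul_mem _ c hx
  | zero => simp
  | add x y _ _ hx hy => rw [TensorProduct.add_tmul]; exact add_mem hx hy
  | smul c x _ hx => rw [← TensorProduct.smul_tmul']; exact Submodule.smul_mem _ c hx

theorem left_e_mm (a b : Fin k) (α β : Fin k →₀ ℕ) : tens (e a b) 1 (mm α β) =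
    (α b : ℂ) • mm (α - Finsupp.single b 1 + Finsupp.single a 1) β := by
  rw [mm, TensorProduct.map_tmul, e_eq, mX_mul_dX_monomial, ← TensorProduct.smul_tmul']; rfl

theorem right_e_mm (a b : Fin k) (α β : Fin k →₀ ℕ) : tens 1 (e a b) (mm α β) =
    (β b : ℂ) • mm α (β - Finsupp.single b 1 + Finsupp.single a 1) := by
  rw [mm, TensorProduct.map_tmul, e_eq, mX_mul_dX_monomial, TensorProduct.tmul_smul]; rfl

/-- The operator `e₁₂` of `gl_2` on `𝕍 ⊗ 𝕍`. -/
def sqE (k : ℕ) : Module.End ℂ (VV k ⊗[ℂ] VV k) := ∑ a : Fin k, tens (mX a) 1 * tens 1 (dX a)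
/-- The operator `e₂₁` of `gl_2` on `𝕍 ⊗ 𝕍`. -/
def sqF (k : ℕ) : Module.End ℂ (VV k ⊗[ℂ] VV k) := ∑ a : Fin k, tens 1 (mX a) * tens (dX a) 1
/-- The operator `e₁₁` of `gl_2` on `𝕍 ⊗ 𝕍`. -/
def sqH₁ (k : ℕ) : Module.End ℂ (VV k ⊗[ℂ] VV k) := ∑ a : Fin k, tens (mX a) 1 * tens (dX a) 1
/-- The operator `e₂₂` of `gl_2` on `𝕍 ⊗ 𝕍`. -/
def sqH₂ (k : ℕ) : Module.End ℂ (VV k ⊗[ℂ] VV k) := ∑ a : Fin k, tens 1 (mX a) * tens 1 (dX a)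

theorem hasWt_mm (α β : Fin k →₀ ℕ) : HasWt (sqH₁ k) (sqH₂ k) α.degree β.degree (mm α β) := by
  constructor
  · rw [sqH₁, LinearMap.sum_apply, Finsupp.degree_eq_sum, Nat.cast_sum, Finset.sum_smul]
    refine Finset.sum_congr rfl fun a _ => ?_
    rw [tens_mul, mm, TensorProduct.map_tmul, mX_mul_dX_self_monomial, ← TensorProduct.smul_tmul']
    rfl
  · rw [sqH₂, LinearMap.sum_apply, Finsupp.degree_eq_sum, Nat.cast_sum, Finset.sum_smul]
    refine Finset.sum_congr rfl fun a _ => ?_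
    rw [tens_mul, mm, TensorProduct.map_tmul, mX_mul_dX_self_monomial, TensorProduct.tmul_smul]
    rfl

theorem wtSpan_square : WtSpan (sqH₁ k) (sqH₂ k) := by
  refine top_le_iff.1 (span_mm.ge.trans (Submodule.span_mono ?_))
  rintro v ⟨α, β, rfl⟩
  exact ⟨_, _, hasWt_mm α β⟩

theorem gl2_square : GL2 (sqE k) (sqF k) (sqH₁ k) (sqH₂ k) :=
  weyl_square.gl2 wtSpan_square

theorem mm_mem_VlVm (α β : Fin k →₀ ℕ) : mm α β ∈ VlVm k α.degree β.degree := by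
  refine ⟨⟨MvPolynomial.monomial α 1, ?_⟩ ⊗ₜ ⟨MvPolynomial.monomial β 1, ?_⟩, ?_⟩
  · exact MvPolynomial.isHomogeneous_monomial _ rfl
  · exact MvPolynomial.isHomogeneous_monomial _ rfl
  · rfl

/-- One direction is Euler's identity. The other uses the spectral projector onto weight `(l, m)`:
it maps every product of monomials into `V_l ⊗ V_m` and fixes vectors of that weight. -/
theorem mem_VlVm_iff {l m : ℕ} {w : VV k ⊗[ℂ] VV k} :
    w ∈ VlVm k l m ↔ HasWt (sqH₁ k) (sqH₂ k) l m w := by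
  classical
  constructor
  · rintro ⟨w, rfl⟩
    induction w using TensorProduct.induction_on with
    | zero => simp [HasWt]
    | add x y hx hy =>
      rw [map_add]
      exact ⟨by rw [map_add, hx.1, hy.1, smul_add], by rw [map_add, hx.2, hy.2, smul_add]⟩
    | tmul p q =>
      obtain ⟨p, hp⟩ := p
      obtain ⟨q, hq⟩ := q
      have hp' := MvPolynomial.IsHomogeneous.sum_X_mul_pderiv hp
      have hq' := MvPolynomial.IsHomogeneous.sum_X_mul_pderiv hq
      rw [TensorProduct.map_tmul]
      constructor
      · simp only [sqH₁, LinearMap.sum_apply, tens_mul, TensorProduct.map_tmul, Submodule.subtype_apply,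
          ← TensorProduct.sum_tmul, Module.End.mul_apply, mX_apply, dX_apply, hp', one_mul,
          Module.End.one_apply]
        rw [← Nat.cast_smul_eq_nsmul ℂ, ← TensorProduct.smul_tmul']
      · simp only [sqH₂, LinearMap.sum_apply, tens_mul, TensorProduct.map_tmul, Submodule.subtype_apply,
          ← TensorProduct.tmul_sum, Module.End.mul_apply, mX_apply, dX_apply, hq', one_mul,
          Module.End.one_apply]
        rw [← Nat.cast_smul_eq_nsmul ℂ, TensorProduct.tmul_smul]
  · intro hw
    let f : ℕ → ℂ → ℂ := fun l μ => if μ = l then 1 else 0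
    have hproj : ∀ w, opFun (f l) (sqH₁ k) (opFun (f m) (sqH₂ k) w) ∈ VlVm k l m := by
      intro w
      have hw : w ∈ Submodule.span ℂ {v : VV k ⊗[ℂ] VV k | ∃ α β, v = mm α β} := by
        rw [span_mm]; trivial
      induction hw using Submodule.span_induction with
      | zero => simp
      | add x y _ _ hx hy => simp only [map_add]; exact add_mem hx hy
      | smul c x _ hx => simp only [map_smul]; exact Submodule.smul_mem _ c hx
      | mem v hv =>
        obtain ⟨α, β, rfl⟩ := hv
        have h := hasWt_mm α β
        rw [opFun_apply wtSpan_square.eigSpan_right _ h.2, map_smul,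
          opFun_apply wtSpan_square.eigSpan_left _ h.1, smul_smul]
        by_cases h1 : α.degree = l
        · by_cases h2 : β.degree = m
          · refine Submodule.smul_mem _ _ ?_
            rw [← h1, ← h2]
            exact mm_mem_VlVm α β
          · simp [f, h2]
        · simp [f, h1]
    have := hproj w
    rwa [opFun_apply wtSpan_square.eigSpan_right _ hw.2, map_smul,
      opFun_apply wtSpan_square.eigSpan_left _ hw.1, smul_smul,
      show f m m * f l l = 1 by simp [f], one_smul] at this

/-! ### The normalization: the Chu–Vandermonde identity -/

/-- Induction on `m` with `l` and `u` free: Pascal's rule splits the sum into the one for `(l, u)`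
and a multiple of the one for `(l + 1, u - 1)`. The closed forms of the two share a numerator, as `u
+ l` is unchanged. -/
theorem chu_vandermonde (m : ℕ) (l : ℕ) (u : ℂ) (hu : ∀ j : ℕ, u ≠ (j : ℂ) + 1) :
    ∑ s ∈ Finset.range (m + 1), (m.choose s : ℂ) * (((l + s).descFactorial s : ℕ) : ℂ) *
        ∏ j ∈ Finset.range s, (u - (j + 1))⁻¹ =
      ∏ j ∈ Finset.range m, (u + l - j) * (u - (j + 1))⁻¹ := by
  induction m generalizing l u with
  | zero => simp
  | succ m ih =>
    have h1 := ih l u hu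
    have h2 := ih (l + 1) (u - 1) fun j h => hu (j + 1) (by push_cast; linear_combination h)
    have hne : ∀ j : ℕ, u - (j + 1) ≠ 0 := fun j h => hu j (by linear_combination h)
    have hprod : ∀ s : ℕ, ∏ j ∈ Finset.range (s + 1), (u - ((j : ℂ) + 1))⁻¹ =
        (u - 1)⁻¹ * ∏ j ∈ Finset.range s, (u - 1 - ((j : ℂ) + 1))⁻¹ := by
      intro s
      rw [Finset.prod_range_succ', mul_comm]
      congr 1
      · simp
      · refine Finset.prod_congr rfl fun j _ => ?_
        push_cast
        ring_nf
    have hasc : ∀ s : ℕ, (((l + (s + 1)).descFactorial (s + 1) : ℕ) : ℂ) =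
        ((l : ℂ) + 1) * (((l + 1 + s).descFactorial s : ℕ) : ℂ) := by
      intro s
      rw [Nat.descFactorial_succ, show l + (s + 1) - s = l + 1 by omega,
        show l + (s + 1) = l + 1 + s by omega]
      push_cast
      ring
    have hsplit : ∑ s ∈ Finset.range (m + 1 + 1), ((m + 1).choose s : ℂ) *
          (((l + s).descFactorial s : ℕ) : ℂ) * ∏ j ∈ Finset.range s, (u - (j + 1))⁻¹ =
        (∑ s ∈ Finset.range (m + 1), (m.choose s : ℂ) * (((l + s).descFactorial s : ℕ) : ℂ) *
          ∏ j ∈ Finset.range s, (u - (j + 1))⁻¹) +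
        ((l : ℂ) + 1) * (u - 1)⁻¹ * ∑ s ∈ Finset.range (m + 1), (m.choose s : ℂ) *
          (((l + 1 + s).descFactorial s : ℕ) : ℂ) *
            ∏ j ∈ Finset.range s, (u - 1 - (j + 1))⁻¹ := by
      -- One vanishing term, with binomial `m` over `m + 1`, is appended so that both sums have the
      -- same length.
      have h3 : (∑ s ∈ Finset.range (m + 1), (m.choose s : ℂ) *
          (((l + s).descFactorial s : ℕ) : ℂ) * ∏ j ∈ Finset.range s, (u - (j + 1))⁻¹) =
          ∑ s ∈ Finset.range (m + 1 + 1), (m.choose s : ℂ) *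
          (((l + s).descFactorial s : ℕ) : ℂ) * ∏ j ∈ Finset.range s, (u - (j + 1))⁻¹ := by
        rw [Finset.sum_range_succ _ (m + 1), Nat.choose_succ_self]
        simp
      rw [h3, Finset.sum_range_succ', Finset.sum_range_succ' _ (m + 1), Finset.mul_sum,
        add_right_comm, ← Finset.sum_add_distrib]
      congr 1
      · refine Finset.sum_congr rfl fun s _ => ?_
        rw [hprod, hasc, Nat.choose_succ_succ]
        push_cast
        ring
      · simp
    have hD := hprod m
    rw [Finset.prod_range_succ] at hD
    rw [hsplit, h1, h2, Finset.prod_mul_distrib, Finset.prod_mul_distrib, Finset.prod_mul_distrib,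
      Finset.prod_range_succ, Finset.prod_range_succ]
    have hnum : ∏ j ∈ Finset.range m, (u - 1 + ((l + 1 : ℕ) : ℂ) - j) =
        ∏ j ∈ Finset.range m, (u + l - j) := Finset.prod_congr rfl fun j _ => by
      push_cast; ring
    rw [hnum]
    have hm := hne m
    generalize ∏ j ∈ Finset.range m, (u + l - (j : ℂ)) = A at *
    generalize ∏ j ∈ Finset.range m, (u - ((j : ℂ) + 1))⁻¹ = B at *
    generalize ∏ j ∈ Finset.range m, (u - 1 - ((j : ℂ) + 1))⁻¹ = D at *
    have hm' := mul_inv_cancel₀ hm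
    linear_combination (-(l + 1) * A : ℂ) * hD - A * B * hm'

/-- The numerators telescope to `Γ(t + m + 1) / Γ(t + 1)` and the denominators to `Γ(t - l + m) /
Γ(t - l)`. -/
theorem gamma_identity (t : ℂ) (ht : ∀ s : ℤ, t ≠ s) (l m : ℕ) :
    Complex.Gamma (t + 1) * Complex.Gamma (t - l + m) *
        ∏ j ∈ Finset.range m, (t - l + m + l - j) * (t - l + m - (j + 1))⁻¹ =
      Complex.Gamma (t - l) * Complex.Gamma (t + m + 1) := by
  induction m with
  | zero => simp [mul_comm]
  | succ m ih =>
    have h1 : t - l + m ≠ 0 := fun h => ht (l - m) (by push_cast; linear_combination h)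
    have h2 : t + m + 1 ≠ 0 := fun h => ht (-m - 1) (by push_cast; linear_combination h)
    have hp : ∏ j ∈ Finset.range (m + 1), (t - l + ((m + 1 : ℕ) : ℂ) + l - j) *
        (t - l + ((m + 1 : ℕ) : ℂ) - (j + 1))⁻¹ =
        (∏ j ∈ Finset.range m, (t - l + m + l - j) * (t - l + m - (j + 1))⁻¹) *
          ((t + m + 1) * (t - l + m)⁻¹) := by
      rw [Finset.prod_range_succ']
      congr 1
      · refine Finset.prod_congr rfl fun j _ => ?_
        push_cast
        ring_nf
      · push_cast
        ring_nf
    have g1 := Complex.Gamma_add_one _ h1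
    have g2 := Complex.Gamma_add_one _ h2
    rw [hp, show t - l + ((m + 1 : ℕ) : ℂ) = t - l + m + 1 by push_cast; ring,
      show t + ((m + 1 : ℕ) : ℂ) + 1 = t + m + 1 + 1 by push_cast; ring, g1, g2]
    have h3 := mul_inv_cancel₀ h1
    linear_combination ((t - l + m) * (t - l + m)⁻¹ * (t + m + 1)) * ih +
      Complex.Gamma (t - l) * Complex.Gamma (t + m + 1) * (t + m + 1) * h3

/-- The sum is the eigenvalue of `B` on `x_1^l ⊗ x_1^m`, where `E^s` and then `F^s` contribute the
falling factorials. This identity is why `C` is the right normalizing factor. -/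
theorem cval_mul_sum (t : ℂ) (ht : ∀ s : ℤ, t ≠ s) (l m : ℕ) :
    cval t l m * ∑ s ∈ Finset.range (m + 1), bco t (l - m) s *
      ((m.descFactorial s : ℕ) * ((l + s).descFactorial s : ℕ) : ℂ) = 1 := by
  have h := chu_vandermonde m l (t - l + m) fun j h => ht (j + 1 + l - m) (by
    push_cast
    linear_combination h)
  have h2 : ∑ s ∈ Finset.range (m + 1), bco t (l - m) s *
      ((m.descFactorial s : ℕ) * ((l + s).descFactorial s : ℕ) : ℂ) =
      ∏ j ∈ Finset.range m, (t - l + m + l - j) * (t - l + m - (j + 1))⁻¹ := by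
    rw [← h]
    refine Finset.sum_congr rfl fun s _ => ?_
    have hb : bco t (l - m) s = ((s.factorial : ℕ) : ℂ)⁻¹ *
        ∏ j ∈ Finset.range s, (t - l + m - ((j : ℂ) + 1))⁻¹ := by
      rw [bco, ← Finset.prod_range_add_one_eq_factorial, Nat.cast_prod, ← Finset.prod_inv_distrib,
        ← Finset.prod_mul_distrib]
      refine Finset.prod_congr rfl fun j _ => ?_
      rw [mul_inv]
      push_cast
      ring_nf
    rw [hb, Nat.descFactorial_eq_factorial_mul_choose m s]
    have hs : ((s.factorial : ℕ) : ℂ) ≠ 0 := Nat.cast_ne_zero.2 s.factorial_ne_zero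
    push_cast
    field_simp
  have g := gamma_identity t ht l m
  have n1 : Complex.Gamma (t - l) ≠ 0 := Complex.Gamma_ne_zero fun r h =>
    ht (l - r) (by push_cast; linear_combination h)
  have n2 : Complex.Gamma (t + m + 1) ≠ 0 := Complex.Gamma_ne_zero fun r h =>
    ht (-r - m - 1) (by push_cast; linear_combination h)
  rw [h2, cval, show t - ((l : ℂ) - m) = t - l + m by ring]
  generalize ∏ j ∈ Finset.range m, (t - l + m + l - j) * (t - l + m - ((j : ℂ) + 1))⁻¹ = A at g
  field_simp
  linear_combination g

/-! ### The rational `R`-matrix -/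

/-- The rational `R`-matrix as an operator of the dual `gl_2`. -/
def sqR (k : ℕ) (t : ℂ) : Module.End ℂ (VV k ⊗[ℂ] VV k) :=
  genC (sqH₁ k) (sqH₂ k) t * genB (sqE k) (sqF k) (sqH₁ k) (sqH₂ k) t

theorem tens_left_e (a b : Fin k) : tens (e a b) 1 = tens (mX a) 1 * tens (dX b) 1 := by
  rw [tens_mul, one_mul, e_eq]

theorem tens_right_e (a b : Fin k) : tens 1 (e a b) = tens 1 (mX a) * tens 1 (dX b) := by
  rw [tens_mul, one_mul, e_eq]

/-- Summation over `c` assembles the operator `F` of the dual `gl_2`; on the other side of the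
relation it assembles `E`. This brings the relation into the form treated by `Weyl2.genB_relation`.
-/
theorem relation_left (t : ℂ) (a b : Fin k) :
    t • tens (e a b) 1 + ∑ c, tens (e a c) (e c b) =
      t • (tens (mX a) 1 * tens (dX b) 1) + tens (mX a) 1 * sqF k * tens 1 (dX b) := by
  rw [tens_left_e, sqF, Finset.mul_sum, Finset.sum_mul]
  congr 1
  refine Finset.sum_congr rfl fun c _ => ?_
  simp only [tens_mul, mul_one, one_mul, e_eq]

theorem relation_right (t : ℂ) (a b : Fin k) :
    t • tens (e a b) 1 + ∑ c, tens (e c b) (e a c) =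
      t • (tens (mX a) 1 * tens (dX b) 1) + tens 1 (mX a) * sqE k * tens (dX b) 1 := by
  rw [tens_left_e, sqE, Finset.mul_sum, Finset.sum_mul]
  congr 1
  refine Finset.sum_congr rfl fun c _ => ?_
  simp only [tens_mul, mul_one, one_mul, e_eq]

theorem sqE_apply_pow [NeZero k] (l m : ℕ) :
    sqE k ((MvPolynomial.X 0 ^ l : VV k) ⊗ₜ[ℂ] (MvPolynomial.X 0 ^ m : VV k)) =
      (m : ℂ) • ((MvPolynomial.X 0 ^ (l + 1) : VV k) ⊗ₜ[ℂ] (MvPolynomial.X 0 ^ (m - 1) : VV k)) := by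
  rw [sqE, LinearMap.sum_apply, Finset.sum_eq_single 0]
  · rw [tens_mul, TensorProduct.map_tmul, mul_one, one_mul, mX_apply, dX_apply,
      MvPolynomial.pderiv_pow, MvPolynomial.pderiv_X_self, mul_one, ← pow_succ', ← nsmul_eq_mul,
      ← Nat.cast_smul_eq_nsmul ℂ, TensorProduct.tmul_smul]
  · intro b _ hb
    rw [tens_mul, TensorProduct.map_tmul, one_mul, dX_apply, MvPolynomial.pderiv_pow,
      MvPolynomial.pderiv_X_of_ne hb.symm, mul_zero, TensorProduct.tmul_zero]
  · simp

theorem sqF_apply_pow [NeZero k] (l m : ℕ) :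
    sqF k ((MvPolynomial.X 0 ^ l : VV k) ⊗ₜ[ℂ] (MvPolynomial.X 0 ^ m : VV k)) =
      (l : ℂ) • ((MvPolynomial.X 0 ^ (l - 1) : VV k) ⊗ₜ[ℂ] (MvPolynomial.X 0 ^ (m + 1) : VV k)) := by
  rw [sqF, LinearMap.sum_apply, Finset.sum_eq_single 0]
  · rw [tens_mul, TensorProduct.map_tmul, mul_one, one_mul, mX_apply, dX_apply,
      MvPolynomial.pderiv_pow, MvPolynomial.pderiv_X_self, mul_one, ← pow_succ', ← nsmul_eq_mul,
      ← Nat.cast_smul_eq_nsmul ℂ, TensorProduct.smul_tmul']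
  · intro b _ hb
    rw [tens_mul, TensorProduct.map_tmul, one_mul, dX_apply, MvPolynomial.pderiv_pow,
      MvPolynomial.pderiv_X_of_ne hb.symm, mul_zero, TensorProduct.zero_tmul]
  · simp

theorem sqE_pow_apply_pow [NeZero k] (s l m : ℕ) :
    (sqE k ^ s) ((MvPolynomial.X 0 ^ l : VV k) ⊗ₜ[ℂ] (MvPolynomial.X 0 ^ m : VV k)) =
      (m.descFactorial s : ℂ) •
        ((MvPolynomial.X 0 ^ (l + s) : VV k) ⊗ₜ[ℂ] (MvPolynomial.X 0 ^ (m - s) : VV k)) := by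
  induction s with
  | zero => simp
  | succ s ih =>
    rw [pow_succ', Module.End.mul_apply, ih, map_smul, sqE_apply_pow, smul_smul,
      Nat.descFactorial_succ, Nat.cast_mul, mul_comm, Nat.sub_sub, add_assoc]

theorem sqF_pow_apply_pow [NeZero k] (s l m : ℕ) :
    (sqF k ^ s) ((MvPolynomial.X 0 ^ l : VV k) ⊗ₜ[ℂ] (MvPolynomial.X 0 ^ m : VV k)) =
      (l.descFactorial s : ℂ) •
        ((MvPolynomial.X 0 ^ (l - s) : VV k) ⊗ₜ[ℂ] (MvPolynomial.X 0 ^ (m + s) : VV k)) := by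
  induction s with
  | zero => simp
  | succ s ih =>
    rw [pow_succ', Module.End.mul_apply, ih, map_smul, sqF_apply_pow, smul_smul,
      Nat.descFactorial_succ, Nat.cast_mul, mul_comm, Nat.sub_sub, add_assoc]

theorem pow_tmul_pow [NeZero k] (l m : ℕ) :
    (MvPolynomial.X 0 ^ l : VV k) ⊗ₜ[ℂ] (MvPolynomial.X 0 ^ m : VV k) =
      mm (Finsupp.single 0 l) (Finsupp.single 0 m) := by
  rw [mm, MvPolynomial.X_pow_eq_monomial, MvPolynomial.X_pow_eq_monomial]

theorem isRMatrix_sqR [NeZero k] {t : ℂ} (ht : ∀ s : ℤ, t ≠ s) : IsRMatrix t (sqR k t) where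
  preserves l m w hw := by
    rw [mem_VlVm_iff] at hw ⊢
    have h := gl2_square.genB_hasWt ht hw
    rw [sqR, Module.End.mul_apply, genC_apply wtSpan_square t h]
    exact ⟨by rw [map_smul, h.1, smul_comm], by rw [map_smul, h.2, smul_comm]⟩
  invariant a b := by
    have W := weyl_square (k := k)
    have hE := W.invariant_comm a b
    have hF := W.swap.invariant_comm a b
    rw [add_comm (tens 1 (mX a) * _)] at hF
    have c1 := W.invariant_comm_H a b
    have c2 := W.swap.invariant_comm_H a b
    rw [add_comm (tens 1 (mX a) * _)] at c2
    rw [tens_left_e, tens_right_e]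
    refine LinearMap.ext fun v => ?_
    rw [sqR, Module.End.mul_apply, Module.End.mul_apply, Module.End.mul_apply, Module.End.mul_apply,
      genC_intertwine wtSpan_square wtSpan_square t
        (Φ := tens (mX a) 1 * tens (dX b) 1 + tens 1 (mX a) * tens 1 (dX b))
        (fun v => LinearMap.congr_fun c1 v) fun v => LinearMap.congr_fun c2 v,
      genB_intertwine gl2_square gl2_square ht
        (Φ := tens (mX a) 1 * tens (dX b) 1 + tens 1 (mX a) * tens 1 (dX b)) (fun v => LinearMap.congr_fun hE v)
        (fun v => LinearMap.congr_fun hF v) (fun v => LinearMap.congr_fun c1 v)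
        fun v => LinearMap.congr_fun c2 v]
  relation a b := by
    rw [relation_left, relation_right]
    refine wtSpan_square.ext fun l m v hv => ?_
    obtain ⟨c1, c2⟩ := (weyl_square (k := k)).relation_right_comm t a b
    have hB := weyl_square.genB_relation wtSpan_square ht a b hv
    have hC := genC_intertwine wtSpan_square wtSpan_square t
      (Φ := t • (tens (mX a) 1 * tens (dX b) 1) + tens 1 (mX a) * sqE k * tens (dX b) 1)
      -- The right-hand operator commutes with both weights, hence with `C`, so the relation for `B`
      -- alone gives the one for `C B`.
      (fun v => LinearMap.congr_fun c1 v) (fun v => LinearMap.congr_fun c2 v) (genB (sqE k) (sqF k) (sqH₁ k) (sqH₂ k) t v)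
    exact (congrArg (genC (sqH₁ k) (sqH₂ k) t) hB).trans hC.symm
  normalized l m := by
    have hw : HasWt (sqH₁ k) (sqH₂ k) l m
        ((MvPolynomial.X 0 ^ l : VV k) ⊗ₜ[ℂ] (MvPolynomial.X 0 ^ m : VV k)) := by
      have := hasWt_mm (Finsupp.single (0 : Fin k) l) (Finsupp.single (0 : Fin k) m)
      rwa [Finsupp.degree_single, Finsupp.degree_single, ← pow_tmul_pow] at this
    have h : ∀ s ∈ Finset.range (m + 1), bco t (l - m) s • (sqF k ^ s * sqE k ^ s)
        ((MvPolynomial.X 0 ^ l : VV k) ⊗ₜ[ℂ] (MvPolynomial.X 0 ^ m : VV k)) =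
        (bco t (l - m) s * ((m.descFactorial s : ℕ) * ((l + s).descFactorial s : ℕ) : ℂ)) •
        ((MvPolynomial.X 0 ^ l : VV k) ⊗ₜ[ℂ] (MvPolynomial.X 0 ^ m : VV k)) := by
      intro s hs
      rw [Module.End.mul_apply, sqE_pow_apply_pow, map_smul, sqF_pow_apply_pow, smul_smul, smul_smul,
        Nat.add_sub_cancel, Nat.sub_add_cancel (Nat.lt_succ_iff.1 (Finset.mem_range.1 hs)), mul_assoc]
    rw [sqR, Module.End.mul_apply, gl2_square.genB_apply ht hw m.lt_succ_self,
      Finset.sum_congr rfl h, ← Finset.sum_smul, map_smul, genC_apply wtSpan_square t hw, smul_smul,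
      mul_comm, cval_mul_sum t ht, one_smul]

end Square

/-! ### Uniqueness of the `R`-matrix -/

section Unique

variable {k : ℕ}

theorem degree_move {α : Fin k →₀ ℕ} {a b : Fin k} (h : α a ≠ 0) :
    (α - Finsupp.single a 1 + Finsupp.single b 1).degree = α.degree := by
  have hle : Finsupp.single a 1 ≤ α := by simpa [Nat.one_le_iff_ne_zero] using h
  have := congrArg Finsupp.degree (tsub_add_cancel_of_le hle)
  simp only [map_add, Finsupp.degree_single] at this ⊢
  exact this

theorem move_move {α : Fin k →₀ ℕ} {a b : Fin k} (h : α a ≠ 0) :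
    α - Finsupp.single a 1 + Finsupp.single b 1 - Finsupp.single b 1 + Finsupp.single a 1 = α := by
  have hle : Finsupp.single a 1 ≤ α := by simpa [Nat.one_le_iff_ne_zero] using h
  rw [add_tsub_cancel_right, tsub_add_cancel_of_le hle]

variable [NeZero k]

theorem degree_eq_add_erase (α : Fin k →₀ ℕ) :
    α.degree = α 0 + ∑ c ∈ Finset.univ.erase 0, α c := by
  rw [Finsupp.degree_eq_sum, Finset.add_sum_erase _ _ (Finset.mem_univ _)]

theorem exists_ne_zero_of_degree {α : Fin k →₀ ℕ} {p : ℕ} (h : α.degree = α 0 + (p + 1)) :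
    ∃ a, a ≠ 0 ∧ α a ≠ 0 := by
  by_contra! hn
  have : ∑ c ∈ Finset.univ.erase 0, α c = 0 :=
    Finset.sum_eq_zero fun c hc => hn c (Finset.ne_of_mem_erase hc)
  rw [degree_eq_add_erase, this] at h
  omega

theorem eq_single_of_degree {α : Fin k →₀ ℕ} (h : α.degree = α 0) : α = Finsupp.single 0 (α 0) := by
  rw [degree_eq_add_erase] at h
  have h0 : ∑ c ∈ Finset.univ.erase 0, α c = 0 := by omega
  rw [Finset.sum_eq_zero_iff] at h0
  ext c
  by_cases hc : c = 0
  · subst hc; simp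
  · rw [h0 c (Finset.mem_erase.2 ⟨hc, Finset.mem_univ _⟩), Finsupp.single_eq_of_ne hc]

/-- In the image of the vector, `t e_{a0} ⊗ 1` and the term `c = 0` give the same vector with total
factor `t + β 0`, nonzero because `t` is not an integer. The terms with `c ≠ 0` lie in `S` by
assumption and can be subtracted. -/
theorem left_mem_of_relation {t : ℂ} (ht : ∀ s : ℤ, t ≠ s) {S : Submodule ℂ (VV k ⊗[ℂ] VV k)}
    (hL : ∀ a, ∀ v ∈ S, (t • tens (e a 0) 1 + ∑ c, tens (e a c) (e c 0)) v ∈ S)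
    {a : Fin k} {α β : Fin k →₀ ℕ} (hv : mm α β ∈ S)
    (hc : ∀ c ≠ 0, α c ≠ 0 → β 0 ≠ 0 →
      mm (α - Finsupp.single c 1 + Finsupp.single a 1)
        (β - Finsupp.single 0 1 + Finsupp.single c 1) ∈ S) :
    (α 0 : ℂ) • mm (α - Finsupp.single 0 1 + Finsupp.single a 1) β ∈ S := by
  have key : ∀ c, tens (e a c) (e c 0) (mm α β) = ((α c : ℂ) * (β 0 : ℂ)) •
      mm (α - Finsupp.single c 1 + Finsupp.single a 1)
        (β - Finsupp.single 0 1 + Finsupp.single c 1) := by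
    intro c
    rw [show tens (e a c) (e c 0) = tens 1 (e c 0) * tens (e a c) 1 by
      rw [tens_mul, one_mul, mul_one], Module.End.mul_apply, left_e_mm, map_smul, right_e_mm,
      smul_smul]
  have hsum : ∑ c ∈ Finset.univ.erase 0, tens (e a c) (e c 0) (mm α β) ∈ S := by
    refine Submodule.sum_mem _ fun c hcm => ?_
    rw [key]
    by_cases h1 : α c = 0
    · simp [h1]
    by_cases h2 : β 0 = 0
    · simp [h2]
    exact Submodule.smul_mem _ _ (hc c (Finset.ne_of_mem_erase hcm) h1 h2)
  have hv' := hL a _ hv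
  rw [LinearMap.add_apply, LinearMap.smul_apply, LinearMap.sum_apply,
    ← Finset.add_sum_erase _ _ (Finset.mem_univ (0 : Fin k)), ← add_assoc] at hv'
  have h3 := (Submodule.add_mem_iff_left S hsum).1 hv'
  -- Truncated subtraction breaks the identity of exponents when `β 0 = 0`, but the coefficient
  -- vanishes there.
  have hβ : ((β 0 : ℕ) : ℂ) • mm (α - Finsupp.single 0 1 + Finsupp.single a 1)
      (β - Finsupp.single 0 1 + Finsupp.single 0 1) =
      ((β 0 : ℕ) : ℂ) • mm (α - Finsupp.single 0 1 + Finsupp.single a 1) β := by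
    by_cases h2 : β 0 = 0
    · simp [h2]
    · rw [tsub_add_cancel_of_le (by simpa [Nat.one_le_iff_ne_zero] using h2)]
  rw [key, left_e_mm, mul_smul, hβ, smul_comm, ← smul_add, ← add_smul, smul_comm] at h3
  have hne : t + (β 0 : ℂ) ≠ 0 := fun h => ht (-(β 0 : ℤ)) (by
    push_cast
    linear_combination h)
  exact (Submodule.smul_mem_iff S hne).1 h3

/-- The vectors `x_1^l ⊗ x_1^m` generate `𝕍 ⊗ 𝕍` under the operators occurring in the relations for
the `R`-matrix. -/
theorem eq_top_of_relation {t : ℂ} (ht : ∀ s : ℤ, t ≠ s) {S : Submodule ℂ (VV k ⊗[ℂ] VV k)}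
    (hL : ∀ a, ∀ v ∈ S, (t • tens (e a 0) 1 + ∑ c, tens (e a c) (e c 0)) v ∈ S)
    (hT : ∀ a : Fin k, ∀ v ∈ S, (tens (e a 0) 1 + tens 1 (e a 0)) v ∈ S)
    (h0 : ∀ l m : ℕ, mm (Finsupp.single 0 l) (Finsupp.single 0 m) ∈ S) : S = ⊤ := by
  -- `N` counts the letters other than `x_1` in both factors and `p` those in the left factor. The
  -- outer induction is on `N`, the inner one on `p`.
  have main : ∀ N p : ℕ, ∀ α β : Fin k →₀ ℕ, α.degree = α 0 + p → β.degree + p = β 0 + N →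
      mm α β ∈ S := by
    intro N
    induction N with
    | zero =>
      intro p α β hα hβ
      have hβ' := degree_eq_add_erase β
      have hp : p = 0 := by omega
      subst hp
      rw [eq_single_of_degree (α := α) (by omega), eq_single_of_degree (α := β) (by omega)]
      exact h0 _ _
    | succ N ihN =>
      intro p
      induction p with
      | zero =>
        intro α β hα hβ
        obtain ⟨a, ha, hβa⟩ := exists_ne_zero_of_degree (α := β) (p := N) (by omega)
        -- With only `x_1` on the left, replace a letter `x_a` on the right by `x_1`, which lowers
        -- `N`. The total action of `e_{a0}` restores it, up to a term with `x_a` on the left that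
        -- is already in `S`.
        have hv : mm α (β - Finsupp.single a 1 + Finsupp.single 0 1) ∈ S := by
          refine ihN 0 _ _ hα ?_
          rw [degree_move hβa]
          simp [ha.symm]
          omega
        have h1 := left_mem_of_relation ht hL (a := a) hv fun c hc hαc _ => by
          rw [eq_single_of_degree hα, Finsupp.single_eq_of_ne hc] at hαc
          exact absurd rfl hαc
        have h2 := hT a _ hv
        rw [LinearMap.add_apply, left_e_mm, right_e_mm] at h2
        have h3 := (Submodule.add_mem_iff_right S h1).1 h2
        rw [move_move hβa] at h3
        refine (Submodule.smul_mem_iff S ?_).1 h3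
        rw [Nat.cast_ne_zero]
        simp
      | succ p ihp =>
        intro α β hα hβ
        obtain ⟨a, ha, hαa⟩ := exists_ne_zero_of_degree hα
        have e0 : (α - Finsupp.single a 1 + Finsupp.single 0 1 : Fin k →₀ ℕ) 0 = α 0 + 1 := by simp [ha.symm]
        -- Replacing a letter `x_a` on the left by `x_1` lowers `N`. When it is restored, the extra
        -- terms move another letter `x_c` to the right, which keeps the total but lowers `p`, so
        -- the inner induction covers them.
        have hv : mm (α - Finsupp.single a 1 + Finsupp.single 0 1) β ∈ S := by
          refine ihN p _ _ ?_ (by omega)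
          rw [degree_move hαa, e0]
          omega
        have h1 := left_mem_of_relation ht hL (a := a) hv fun c hc hαc hβ0 => by
          refine ihp _ _ ?_ ?_
          · rw [degree_move hαc, degree_move hαa]
            simp [ha.symm, hc.symm]
            omega
          · rw [degree_move hβ0]
            simp [hc.symm]
            omega
        rw [move_move hαa] at h1
        refine (Submodule.smul_mem_iff S ?_).1 h1
        rw [Nat.cast_ne_zero, e0]
        simp
  rw [← top_le_iff, ← span_mm, Submodule.span_le]
  rintro v ⟨α, β, rfl⟩
  have hα := degree_eq_add_erase α
  have hβ := degree_eq_add_erase β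
  exact main _ _ α β hα (by rw [hβ, add_assoc])

/-- The subspace where two solutions agree contains all `x_1^l ⊗ x_1^m`. It is stable under the
left-hand operators of the relations, because each solution turns them into right-hand operators
applied to the common value. -/
theorem IsRMatrix.unique {t : ℂ} (ht : ∀ s : ℤ, t ≠ s) {R R' : Module.End ℂ (VV k ⊗[ℂ] VV k)}
    (h : IsRMatrix t R) (h' : IsRMatrix t R') : R = R' := by
  have : LinearMap.eqLocus R R' = ⊤ := by
    refine eq_top_of_relation ht (fun a v hv => ?_) (fun a v hv => ?_) fun l m => ?_
    · have e1 := LinearMap.congr_fun (h.relation a 0) v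
      have e2 := LinearMap.congr_fun (h'.relation a 0) v
      rw [Module.End.mul_apply, Module.End.mul_apply] at e1 e2
      rw [LinearMap.mem_eqLocus] at hv ⊢
      rw [e1, e2, hv]
    · have e1 := LinearMap.congr_fun (h.invariant a 0) v
      have e2 := LinearMap.congr_fun (h'.invariant a 0) v
      rw [Module.End.mul_apply, Module.End.mul_apply] at e1 e2
      rw [LinearMap.mem_eqLocus] at hv ⊢
      rw [e1, e2, hv]
    · rw [LinearMap.mem_eqLocus, ← pow_tmul_pow, h.normalized, h'.normalized]
  exact LinearMap.eqLocus_eq_top.1 this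

theorem RMat_eq {t : ℂ} (ht : ∀ s : ℤ, t ≠ s) : RMat k t = sqR k t := by
  have hu : ∃! R : Module.End ℂ (VV k ⊗[ℂ] VV k), IsRMatrix t R :=
    ⟨sqR k t, isRMatrix_sqR ht, fun R' h' => h'.unique ht (isRMatrix_sqR ht)⟩
  rw [RMat, dif_pos hu]
  exact hu.choose_spec.1.unique ht (isRMatrix_sqR ht)

end Unique

/-! ### Operators on tensor products as operators on polynomials -/

section Transport

variable {k n : ℕ} {σ : Type}

/-- The isomorphism of operator algebras induced by `polyIso`. -/
def opIso (g : Fin n × Fin k ≃ σ) :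
    Module.End ℂ (TT k n) ≃ₐ[ℂ] Module.End ℂ (MvPolynomial σ ℂ) :=
  (polyIso g).toLinearEquiv.conjAlgEquiv ℂ

theorem opIso_eq_iff (g : Fin n × Fin k ≃ σ) {A : Module.End ℂ (TT k n)}
    {A' : Module.End ℂ (MvPolynomial σ ℂ)} :
    opIso g A = A' ↔ ∀ p, polyIso g (A (PiTensorProduct.tprod ℂ p)) =
      A' (polyIso g (PiTensorProduct.tprod ℂ p)) := by
  constructor
  · rintro rfl p
    exact congrArg (fun v => polyIso g (A v)) ((polyIso g).symm_apply_apply _).symm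
  · intro h
    have h' : (polyIso g).toLinearEquiv.toLinearMap ∘ₗ A =
        A' ∘ₗ (polyIso g).toLinearEquiv.toLinearMap :=
      PiTensorProduct.ext (MultilinearMap.ext h)
    refine LinearMap.ext fun v => ?_
    have := LinearMap.congr_fun h' ((polyIso g).symm v)
    refine this.trans ?_
    exact congrArg A' ((polyIso g).apply_symm_apply v)

theorem polyIso_apply (g : Fin n × Fin k ≃ σ) (A : Module.End ℂ (TT k n)) (v : TT k n) :
    polyIso g (A v) = opIso g A (polyIso g v) :=
  congrArg (fun v => polyIso g (A v)) ((polyIso g).symm_apply_apply _).symm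

theorem polyIso_symm_opIso (g : Fin n × Fin k ≃ σ) (A : Module.End ℂ (TT k n))
    (v : MvPolynomial σ ℂ) : (polyIso g).symm (opIso g A v) = A ((polyIso g).symm v) := by
  rw [AlgEquiv.symm_apply_eq, polyIso_apply, AlgEquiv.apply_symm_apply]

theorem onFactor_tprod (i : Fin n) (f : Module.End ℂ (VV k)) (p : Fin n → VV k) :
    onFactor i f (PiTensorProduct.tprod ℂ p) =
      PiTensorProduct.tprod ℂ (Function.update p i (f (p i))) := by
  rw [onFactor, PiTensorProduct.map_tprod]
  congr 1
  ext1 j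
  by_cases h : j = i
  · subst h; simp
  · simp [h]

theorem onFactor_mul (i : Fin n) (f f' : Module.End ℂ (VV k)) :
    onFactor i (f * f') = onFactor (n := n) i f * onFactor i f' := by
  refine PiTensorProduct.ext (MultilinearMap.ext fun p => ?_)
  simp [onFactor_tprod]

/-- The contribution of the tensor factors in `s` to the image of a pure tensor. -/
def restProd (g : Fin n × Fin k ≃ σ) (p : Fin n → VV k) (s : Finset (Fin n)) : MvPolynomial σ ℂ :=
  ∏ j ∈ s, MvPolynomial.rename (fun a => g (j, a)) (p j)

theorem restProd_update (g : Fin n × Fin k ≃ σ) (p : Fin n → VV k) {s : Finset (Fin n)} {i : Fin n}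
    (hi : i ∉ s) (q : VV k) : restProd g (Function.update p i q) s = restProd g p s :=
  Finset.prod_congr rfl fun j hj => by
    rw [Function.update_of_ne (fun h : j = i => hi (h ▸ hj))]

theorem polyIso_tprod_eq (g : Fin n × Fin k ≃ σ) (p : Fin n → VV k) (i : Fin n) :
    polyIso g (PiTensorProduct.tprod ℂ p) =
      MvPolynomial.rename (fun a => g (i, a)) (p i) * restProd g p (Finset.univ.erase i) := by
  rw [polyIso_tprod]
  exact (Finset.mul_prod_erase _ (fun j => MvPolynomial.rename (fun a => g (j, a)) (p j))
    (Finset.mem_univ i)).symm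

theorem pderiv_rename_of_ne (g : Fin n × Fin k ≃ σ) {i j : Fin n} (h : j ≠ i) (a : Fin k)
    (q : VV k) : MvPolynomial.pderiv (g (i, a)) (MvPolynomial.rename (fun b => g (j, b)) q) = 0 := by
  classical
  refine MvPolynomial.pderiv_eq_zero_of_notMem_vars fun hmem => ?_
  obtain ⟨b, _, hb⟩ := Finset.mem_image.1 (MvPolynomial.vars_rename _ _ hmem)
  exact h (congrArg Prod.fst (g.injective hb))

theorem pderiv_rename_self (g : Fin n × Fin k ≃ σ) (i : Fin n) (a : Fin k) (q : VV k) :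
    MvPolynomial.pderiv (g (i, a)) (MvPolynomial.rename (fun b => g (i, b)) q) =
      MvPolynomial.rename (fun b => g (i, b)) (MvPolynomial.pderiv a q) :=
  MvPolynomial.pderiv_rename (f := fun b => g (i, b))
    (fun _ _ h => congrArg Prod.snd (g.injective h)) a q

theorem pderiv_restProd (g : Fin n × Fin k ≃ σ) (p : Fin n → VV k) {s : Finset (Fin n)} {i : Fin n}
    (hi : i ∉ s) (a : Fin k) : MvPolynomial.pderiv (g (i, a)) (restProd g p s) = 0 := by
  classical
  induction s using Finset.induction_on with
  | empty => simp [restProd]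
  | insert j s hj ih =>
    rw [Finset.mem_insert, not_or] at hi
    rw [restProd, Finset.prod_insert hj, MvPolynomial.pderiv_mul,
      pderiv_rename_of_ne g (Ne.symm hi.1), zero_mul, zero_add]
    exact (congrArg _ (ih hi.2)).trans (mul_zero _)

theorem opIso_onFactor_mX (g : Fin n × Fin k ≃ σ) (i : Fin n) (a : Fin k) :
    opIso g (onFactor i (mX a)) = mX (g (i, a)) := by
  rw [opIso_eq_iff]
  intro p
  rw [onFactor_tprod, polyIso_tprod_eq g _ i, polyIso_tprod_eq g _ i,
    restProd_update g p (Finset.notMem_erase _ _), Function.update_self, mX_apply, mX_apply, map_mul,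
    MvPolynomial.rename_X, mul_assoc]

theorem opIso_onFactor_dX (g : Fin n × Fin k ≃ σ) (i : Fin n) (a : Fin k) :
    opIso g (onFactor i (dX a)) = dX (g (i, a)) := by
  rw [opIso_eq_iff]
  intro p
  rw [onFactor_tprod, polyIso_tprod_eq g _ i, polyIso_tprod_eq g _ i,
    restProd_update g p (Finset.notMem_erase _ _), Function.update_self, dX_apply, dX_apply,
    MvPolynomial.pderiv_mul, pderiv_restProd g p (Finset.notMem_erase _ _), mul_zero, add_zero,
    pderiv_rename_self]

theorem eAt_eq (i : Fin n) (a b : Fin k) :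
    eAt i a b = onFactor (n := n) i (mX a) * onFactor i (dX b) := by
  rw [eAt, e_eq, onFactor_mul]

theorem opIso_eAt (g : Fin n × Fin k ≃ σ) (i : Fin n) (a b : Fin k) :
    opIso g (eAt i a b) = mX (g (i, a)) * dX (g (i, b)) := by
  rw [eAt_eq, map_mul, opIso_onFactor_mX, opIso_onFactor_dX]

/-! ### The operators on a pair of factors -/

theorem polyIso_insertPair (g : Fin n × Fin k ≃ σ) {i j : Fin n} (h : i ≠ j) (v : Fin n → VV k)
    (p q : VV k) : polyIso g (insertPair h v (p ⊗ₜ q)) =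
      MvPolynomial.rename (fun a => g (i, a)) p * (MvPolynomial.rename (fun a => g (j, a)) q *
        restProd g v ((Finset.univ.erase i).erase j)) := by
  rw [insertPair_tmul, polyIso_tprod_eq g _ i, Function.update_of_ne h, Function.update_self, restProd,
    ← Finset.mul_prod_erase _ _ (Finset.mem_erase.2 ⟨h.symm, Finset.mem_univ j⟩),
    Function.update_self]
  congr 2
  have h1 : i ∉ (Finset.univ.erase i).erase j := by simp
  have h2 : j ∉ (Finset.univ.erase i).erase j := by simp
  exact (restProd_update g _ h2 q).trans (restProd_update g v h1 p)

/-- The map `𝕍 ⊗ 𝕍 → ℂ[σ]` inserting a tensor into the `i`-th and `j`-th places. -/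
def pairMap (g : Fin n × Fin k ≃ σ) {i j : Fin n} (h : i ≠ j) (v : Fin n → VV k) :
    (VV k ⊗[ℂ] VV k) →ₗ[ℂ] MvPolynomial σ ℂ :=
  (polyIso g).toLinearEquiv.toLinearMap ∘ₗ insertPair h v

theorem pairMap_tmul (g : Fin n × Fin k ≃ σ) {i j : Fin n} (h : i ≠ j) (v : Fin n → VV k)
    (p q : VV k) : pairMap g h v (p ⊗ₜ q) =
      MvPolynomial.rename (fun a => g (i, a)) p * (MvPolynomial.rename (fun a => g (j, a)) q *
        restProd g v ((Finset.univ.erase i).erase j)) :=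
  polyIso_insertPair g h v p q

theorem pairMap_mX_left (g : Fin n × Fin k ≃ σ) {i j : Fin n} (h : i ≠ j) (v : Fin n → VV k)
    (a : Fin k) : pairMap g h v ∘ₗ tens (mX a) 1 = mX (g (i, a)) ∘ₗ pairMap g h v :=
  TensorProduct.ext' fun p q => by
    rw [LinearMap.comp_apply, LinearMap.comp_apply, TensorProduct.map_tmul, pairMap_tmul,
      pairMap_tmul, mX_apply, mX_apply, map_mul, MvPolynomial.rename_X, mul_assoc,
      Module.End.one_apply]

theorem pairMap_mX_right (g : Fin n × Fin k ≃ σ) {i j : Fin n} (h : i ≠ j) (v : Fin n → VV k)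
    (a : Fin k) : pairMap g h v ∘ₗ tens 1 (mX a) = mX (g (j, a)) ∘ₗ pairMap g h v :=
  TensorProduct.ext' fun p q => by
    rw [LinearMap.comp_apply, LinearMap.comp_apply, TensorProduct.map_tmul, pairMap_tmul,
      pairMap_tmul, mX_apply, mX_apply, map_mul, MvPolynomial.rename_X, Module.End.one_apply]
    ring

theorem pairMap_dX_left (g : Fin n × Fin k ≃ σ) {i j : Fin n} (h : i ≠ j) (v : Fin n → VV k)
    (a : Fin k) : pairMap g h v ∘ₗ tens (dX a) 1 = dX (g (i, a)) ∘ₗ pairMap g h v :=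
  TensorProduct.ext' fun p q => by
    rw [LinearMap.comp_apply, LinearMap.comp_apply, TensorProduct.map_tmul, pairMap_tmul,
      pairMap_tmul, dX_apply, dX_apply, MvPolynomial.pderiv_mul, MvPolynomial.pderiv_mul,
      pderiv_rename_self, pderiv_rename_of_ne g h.symm, pderiv_restProd g v (by simp),
      Module.End.one_apply]
    ring

theorem pairMap_dX_right (g : Fin n × Fin k ≃ σ) {i j : Fin n} (h : i ≠ j) (v : Fin n → VV k)
    (a : Fin k) : pairMap g h v ∘ₗ tens 1 (dX a) = dX (g (j, a)) ∘ₗ pairMap g h v :=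
  TensorProduct.ext' fun p q => by
    rw [LinearMap.comp_apply, LinearMap.comp_apply, TensorProduct.map_tmul, pairMap_tmul,
      pairMap_tmul, dX_apply, dX_apply, MvPolynomial.pderiv_mul, MvPolynomial.pderiv_mul,
      pderiv_rename_self, pderiv_rename_of_ne g h, pderiv_restProd g v (by simp),
      Module.End.one_apply]
    ring

/-- To identify an operator on two factors it is enough to intertwine it with the insertion of a
two-factor tensor, the remaining factors being frozen. -/
theorem opIso_onPair_eq (g : Fin n × Fin k ≃ σ) {i j : Fin n} (h : i ≠ j)
    {A : Module.End ℂ (VV k ⊗[ℂ] VV k)} {A' : Module.End ℂ (MvPolynomial σ ℂ)}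
    (hA : ∀ v w, pairMap g h v (A w) = A' (pairMap g h v w)) : opIso g (onPair h A) = A' := by
  rw [opIso_eq_iff]
  intro p
  have h1 : onPair h A (PiTensorProduct.tprod ℂ p) = insertPair h p (A (p i ⊗ₜ p j)) :=
    PiTensorProduct.lift.tprod p
  have h2 : insertPair h p (p i ⊗ₜ p j) = PiTensorProduct.tprod ℂ p := by
    rw [insertPair_tmul, Function.update_eq_self, Function.update_eq_self]
  rw [h1, ← h2]
  exact hA p _

/-! ### Diagonal operators -/

/-- Monomials are images of pure tensors of monomials, so diagonal operators on the tensor product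
can be read off on monomials. -/
theorem rename_monomial_prod (g : Fin n × Fin k ≃ σ) (s : σ →₀ ℕ) :
    polyIso g (PiTensorProduct.tprod ℂ fun i => MvPolynomial.monomial
      (Finsupp.equivFunOnFinite.symm fun a => s (g (i, a))) (1 : ℂ)) =
      MvPolynomial.monomial s 1 := by
  classical
  have : Fintype σ := Fintype.ofEquiv _ g
  rw [polyIso_tprod]
  have h : ∀ i, MvPolynomial.rename (fun a => g (i, a)) (MvPolynomial.monomial
      (Finsupp.equivFunOnFinite.symm fun a => s (g (i, a))) (1 : ℂ)) =
      ∏ a, MvPolynomial.X (g (i, a)) ^ s (g (i, a)) := by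
    intro i
    rw [MvPolynomial.monomial_eq, Finsupp.prod_fintype _ _ (by simp)]
    simp
  simp_rw [h]
  rw [← Fintype.prod_prod_type' (f := fun i a => (MvPolynomial.X (g (i, a)) : MvPolynomial σ ℂ) ^ s (g (i, a))),
    MvPolynomial.monomial_eq, Finsupp.prod_fintype _ _ (by simp), map_one, one_mul]
  exact Fintype.prod_equiv g _ _ fun x => rfl

theorem eigSpan_e (a : Fin k) : EigSpan (e a a) := by
  refine top_le_iff.1 (span_monomial.ge.trans (Submodule.span_mono ?_))
  rintro _ ⟨α, rfl⟩
  exact ⟨α a, mX_mul_dX_self_monomial a α⟩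

theorem opIso_onFactor_opFun (g : Fin n × Fin k ≃ σ) (i : Fin n) (a : Fin k) (f : ℂ → ℂ)
    (s : σ →₀ ℕ) : opIso g (onFactor i (opFun f (e a a))) (MvPolynomial.monomial s 1) =
      f (s (g (i, a))) • MvPolynomial.monomial s (1 : ℂ) := by
  rw [← rename_monomial_prod g s, ← polyIso_apply, onFactor_tprod,
    opFun_apply (eigSpan_e a) f (mX_mul_dX_self_monomial a _), MultilinearMap.map_update_smul,
    Function.update_eq_self, map_smul]
  simp

theorem linearMap_ext_monomial {M : Type} [AddCommGroup M] [Module ℂ M]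
    {S T : MvPolynomial σ ℂ →ₗ[ℂ] M}
    (h : ∀ s : σ →₀ ℕ, S (MvPolynomial.monomial s 1) = T (MvPolynomial.monomial s 1)) : S = T := by
  refine LinearMap.ext_on span_monomial ?_
  rintro _ ⟨s, rfl⟩
  exact h s

theorem opIso_eTot_monomial (g : Fin n × Fin k ≃ σ) (a : Fin k) (s : σ →₀ ℕ) :
    opIso g (eTot n a a) (MvPolynomial.monomial s 1) =
      ((∑ i, s (g (i, a)) : ℕ) : ℂ) • MvPolynomial.monomial s (1 : ℂ) := by
  rw [eTot, map_sum, LinearMap.sum_apply, Nat.cast_sum, Finset.sum_smul]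
  exact Finset.sum_congr rfl fun i _ => by rw [opIso_eAt, mX_mul_dX_self_monomial]

theorem wtSpan_opIso_eTot (g : Fin n × Fin k ≃ σ) (a b : Fin k) :
    WtSpan (opIso g (eTot n a a)) (opIso g (eTot n b b)) := by
  refine top_le_iff.1 (span_monomial.ge.trans (Submodule.span_mono ?_))
  rintro _ ⟨s, rfl⟩
  exact ⟨_, _, opIso_eTot_monomial g a s, opIso_eTot_monomial g b s⟩

theorem WtSpan.of_equiv {M M' : Type} [AddCommGroup M] [Module ℂ M] [AddCommGroup M'] [Module ℂ M']
    {H K : Module.End ℂ M} {H' K' : Module.End ℂ M'} (Φ : M ≃ₗ[ℂ] M')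
    (h1 : ∀ v, Φ (H v) = H' (Φ v)) (h2 : ∀ v, Φ (K v) = K' (Φ v)) (h : WtSpan H K) :
    WtSpan H' K' := by
  have := congrArg (Submodule.map Φ.toLinearMap) h
  rw [Submodule.map_span, Submodule.map_top, LinearEquiv.range] at this
  rw [WtSpan, ← top_le_iff, ← this]
  refine Submodule.span_mono ?_
  rintro _ ⟨v, ⟨l, m, hv⟩, rfl⟩
  exact ⟨l, m, hv.map (Φ := Φ.toLinearMap) h1 h2⟩

theorem wtSpan_eTot (n : ℕ) (a b : Fin k) : WtSpan (eTot n a a) (eTot n b b) :=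
  (wtSpan_opIso_eTot (Equiv.refl _) a b).of_equiv (polyIso (Equiv.refl (Fin n × Fin k))).symm.toLinearEquiv
    (polyIso_symm_opIso _ _) (polyIso_symm_opIso _ _)

/-- Here the index set of the Weyl algebra is the set of tensor factors; the relations are checked
on polynomials and pulled back along an injective algebra map. -/
theorem weyl_eTot (n : ℕ) {a b : Fin k} (h : a ≠ b) :
    Weyl2 (fun i : Fin n => onFactor (n := n) i (mX a)) (fun i => onFactor i (mX b))
      (fun i => onFactor i (dX a)) (fun i => onFactor i (dX b)) := by
  classical
  have hinj := (opIso (Equiv.refl (Fin n × Fin k))).injective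
  constructor <;> intro i j <;> apply hinj <;>
    simp only [map_add, map_mul, opIso_onFactor_mX, opIso_onFactor_dX, Equiv.refl_apply]
  · rw [dX_mul_mX]; by_cases hij : i = j <;> simp [hij]
  · rw [dX_mul_mX]; by_cases hij : i = j <;> simp [hij]
  · rw [dX_mul_mX, if_neg (by simp [h]), add_zero]
  · rw [dX_mul_mX, if_neg (by simp [h.symm]), add_zero]
  · exact mX_mul_mX _ _
  · exact mX_mul_mX _ _
  · exact mX_mul_mX _ _
  · exact dX_mul_dX _ _
  · exact dX_mul_dX _ _
  · exact dX_mul_dX _ _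

theorem eTot_eq (n : ℕ) (a b : Fin k) :
    eTot n a b = ∑ i : Fin n, onFactor i (mX a) * onFactor i (dX b) :=
  Finset.sum_congr rfl fun i _ => eAt_eq i a b

theorem gl2_eTot (n : ℕ) {a b : Fin k} (h : a ≠ b) :
    GL2 (eTot n a b) (eTot n b a) (eTot n a a) (eTot n b b) := by
  have hs := wtSpan_eTot n a b
  rw [eTot_eq, eTot_eq] at hs
  rw [eTot_eq, eTot_eq, eTot_eq, eTot_eq]
  exact (weyl_eTot n h).gl2 hs

end Transport

/-! ### Duality for the `R`-matrix -/

section RMatrixDuality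

variable {k n : ℕ}

/-- Operators for `gl_k` as operators on `P_kn`. -/
abbrev opK (k n : ℕ) : Module.End ℂ (TT k n) ≃ₐ[ℂ] Module.End ℂ (PP k n) :=
  opIso (Equiv.prodComm (Fin n) (Fin k))

/-- Operators for `gl_n` as operators on `P_kn`. -/
abbrev opN (k n : ℕ) : Module.End ℂ (TT n k) ≃ₐ[ℂ] Module.End ℂ (PP k n) :=
  opIso (Equiv.refl (Fin k × Fin n))

theorem opK_eAt (i : Fin n) (a b : Fin k) : opK k n (eAt i a b) = mX (a, i) * dX (b, i) :=
  opIso_eAt _ i a b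

theorem opN_eAt (a : Fin k) (i j : Fin n) : opN k n (eAt a i j) = mX (a, i) * dX (a, j) :=
  opIso_eAt _ a i j

theorem intertwine_eTot {M : Type} [AddCommGroup M] [Module ℂ M] {f g : Fin k → Module.End ℂ M}
    {i j : Fin n} (Φ : M →ₗ[ℂ] PP k n) (hf : ∀ a w, Φ (f a w) = mX (a, i) (Φ w))
    (hg : ∀ a w, Φ (g a w) = dX (a, j) (Φ w)) (w : M) :
    Φ ((∑ a, f a * g a) w) = opN k n (eTot k i j) (Φ w) := by
  rw [eTot, map_sum, LinearMap.sum_apply, LinearMap.sum_apply, map_sum]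
  refine Finset.sum_congr rfl fun a _ => ?_
  rw [opN_eAt, Module.End.mul_apply, Module.End.mul_apply, hf, hg]

/-- The `R`-matrix of `gl_k` equals `C B` for `gl_n`. -/
theorem opK_RR [NeZero k] {i j : Fin n} (h : i ≠ j) {t : ℂ} (ht : ∀ s : ℤ, t ≠ s) :
    opK k n (RR i j t) = opN k n (CC k i j t * BB k i j t) := by
  rw [RR, dif_pos h, RMat_eq ht]
  refine opIso_onPair_eq _ h fun v w => ?_
  -- `Ψ` carries the dual `gl_2` of `𝕍 ⊗ 𝕍` to the `gl_2` inside `gl_n` with indices `i`, `j`. Its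
  -- target is the tensor product for `gl_n`, so the intertwining lemmas produce `C_{ij}` and
  -- `B_{ij}` literally.
  let Ψ : (VV k ⊗[ℂ] VV k) →ₗ[ℂ] TT n k :=
    (polyIso (Equiv.refl (Fin k × Fin n))).symm.toLinearMap ∘ₗ
      pairMap (Equiv.prodComm (Fin n) (Fin k)) h v
  have hΨ : ∀ (A : Module.End ℂ (VV k ⊗[ℂ] VV k)) (A' : Module.End ℂ (TT n k)),
      (∀ w, pairMap (Equiv.prodComm (Fin n) (Fin k)) h v (A w) =
        opN k n A' (pairMap (Equiv.prodComm (Fin n) (Fin k)) h v w)) →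
      ∀ w, Ψ (A w) = A' (Ψ w) := by
    intro A A' hA w
    exact (congrArg _ (hA w)).trans (polyIso_symm_opIso _ _ _)
  have mXl : ∀ a w, pairMap (Equiv.prodComm (Fin n) (Fin k)) h v (tens (mX a) 1 w) =
      mX (a, i) (pairMap (Equiv.prodComm (Fin n) (Fin k)) h v w) :=
    fun a => LinearMap.congr_fun (pairMap_mX_left _ h v a)
  have mXr : ∀ a w, pairMap (Equiv.prodComm (Fin n) (Fin k)) h v (tens 1 (mX a) w) =
      mX (a, j) (pairMap (Equiv.prodComm (Fin n) (Fin k)) h v w) :=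
    fun a => LinearMap.congr_fun (pairMap_mX_right _ h v a)
  have dXl : ∀ a w, pairMap (Equiv.prodComm (Fin n) (Fin k)) h v (tens (dX a) 1 w) =
      dX (a, i) (pairMap (Equiv.prodComm (Fin n) (Fin k)) h v w) :=
    fun a => LinearMap.congr_fun (pairMap_dX_left _ h v a)
  have dXr : ∀ a w, pairMap (Equiv.prodComm (Fin n) (Fin k)) h v (tens 1 (dX a) w) =
      dX (a, j) (pairMap (Equiv.prodComm (Fin n) (Fin k)) h v w) :=
    fun a => LinearMap.congr_fun (pairMap_dX_right _ h v a)
  have hE := hΨ (sqE k) (eTot k i j)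
    (intertwine_eTot _ mXl dXr)
  have hF := hΨ (sqF k) (eTot k j i)
    (intertwine_eTot _ mXr dXl)
  have h1 := hΨ (sqH₁ k) (eTot k i i)
    (intertwine_eTot _ mXl dXl)
  have h2 := hΨ (sqH₂ k) (eTot k j j)
    (intertwine_eTot _ mXr dXr)
  have hmain : Ψ (sqR k t w) = (CC k i j t * BB k i j t) (Ψ w) := by
    rw [sqR, Module.End.mul_apply, genC_intertwine wtSpan_square (wtSpan_eTot k i j) t h1 h2,
      genB_intertwine gl2_square (gl2_eTot k h) ht hE hF h1 h2]
    rfl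
  have := congrArg (polyIso (Equiv.refl (Fin k × Fin n))) hmain
  rw [polyIso_apply] at this
  simpa only [Ψ, LinearMap.comp_apply, AlgEquiv.toLinearMap_apply, AlgEquiv.apply_symm_apply] using this

end RMatrixDuality

/-! ### Commuting operators -/

section Commuting

variable {k n : ℕ}

theorem commute_eTot (a b : Fin k) : Commute (eTot n a a) (eTot n b b) := by
  refine (opIso (Equiv.refl (Fin n × Fin k))).injective (linearMap_ext_monomial fun s => ?_)
  simp only [map_mul, Module.End.mul_apply, opIso_eTot_monomial, map_smul]
  rw [smul_comm]

theorem commute_opFun_eTot (i : Fin n) (f : ℂ → ℂ) (a b : Fin k) :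
    Commute (onFactor i (opFun f (e a a))) (eTot n b b) := by
  refine (opIso (Equiv.refl (Fin n × Fin k))).injective (linearMap_ext_monomial fun s => ?_)
  simp only [map_mul, Module.End.mul_apply, opIso_eTot_monomial, map_smul, opIso_onFactor_opFun]
  rw [smul_comm]

theorem commute_CC {A : Module.End ℂ (TT k n)} (hA : ∀ c, Commute A (eTot n c c)) (a b : Fin k)
    (t : ℂ) : Commute A (CC n a b t) :=
  LinearMap.ext fun v => genC_intertwine (wtSpan_eTot n a b) (wtSpan_eTot n a b) t (Φ := A)
    (fun v => LinearMap.congr_fun (hA a) v) (fun v => LinearMap.congr_fun (hA b) v) v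

theorem commute_CC_eTot (a b c : Fin k) (t : ℂ) : Commute (CC n a b t) (eTot n c c) :=
  (commute_CC (fun d => commute_eTot c d) a b t).symm

theorem eTot_mul_eTot (a b c : Fin k) (h1 : c ≠ a) (h2 : c ≠ b) :
    Commute (eTot n c c) (eTot n a b) := by
  have W := weyl_eTot n h1
  have W' := weyl_eTot n h2
  show _ = _
  rw [eTot_eq n c c, eTot_eq n a b]
  exact (sum_mul_comm_of (u := fun i : Fin n => onFactor (n := n) i (mX a))
    (w := fun i => onFactor i (dX b)) (fun i => (W.Hy i).symm) fun i => W'.qH i).symm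

/-- For `c` equal to `a` or `b` this is preservation of weights; otherwise `e_cc` commutes with the
whole `gl_2` of the indices `a`, `b`. -/
theorem commute_BB_eTot {a b : Fin k} (h : a ≠ b) {t : ℂ} (ht : ∀ s : ℤ, t ≠ s) (c : Fin k) :
    Commute (BB n a b t) (eTot n c c) := by
  have G := gl2_eTot n h
  by_cases h1 : c = a
  · subst h1
    refine G.span.ext fun l m v hv => ?_
    rw [Module.End.mul_apply, hv.1, map_smul]
    exact (G.genB_hasWt ht hv).1.symm
  by_cases h2 : c = b
  · subst h2
    refine G.span.ext fun l m v hv => ?_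
    rw [Module.End.mul_apply, hv.2, map_smul]
    exact (G.genB_hasWt ht hv).2.symm
  refine (LinearMap.ext fun v => genB_intertwine G G ht (Φ := eTot n c c) (fun v => ?_) (fun v => ?_)
    (fun v => ?_) (fun v => ?_) v : Commute (eTot n c c) (BB n a b t)).symm
  · exact LinearMap.congr_fun (eTot_mul_eTot a b c h1 h2) v
  · exact LinearMap.congr_fun (eTot_mul_eTot b a c h2 h1) v
  · exact LinearMap.congr_fun (commute_eTot c a) v
  · exact LinearMap.congr_fun (commute_eTot c b) v

theorem list_prod_map_mul {R ι : Type} [Monoid R] {f g : ι → R} (l : List ι)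
    (h : ∀ i ∈ l, ∀ j ∈ l, Commute (f i) (g j)) :
    (l.map fun i => f i * g i).prod = (l.map f).prod * (l.map g).prod := by
  induction l with
  | nil => simp
  | cons a l ih =>
    have hc : Commute (l.map f).prod (g a) := Commute.list_prod_left _ _ fun x hx => by
      obtain ⟨i, hi, rfl⟩ := List.mem_map.1 hx
      exact h i (List.mem_cons_of_mem _ hi) a List.mem_cons_self
    rw [List.map_cons, List.prod_cons, ih fun i hi j hj =>
      h i (List.mem_cons_of_mem _ hi) j (List.mem_cons_of_mem _ hj), List.map_cons, List.prod_cons,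
      List.map_cons, List.prod_cons, mul_assoc, mul_assoc, ← mul_assoc (g a), ← hc.eq, mul_assoc]

/-- Inversion reverses the order, which commutativity makes irrelevant; the factors need not be
units. -/
theorem inverse_list_prod {R ι : Type} [MonoidWithZero R] {f : ι → R} (l : List ι)
    (h : ∀ i ∈ l, ∀ j ∈ l, Commute (f i) (f j)) :
    Ring.inverse (l.map f).prod = (l.map fun i => Ring.inverse (f i)).prod := by
  induction l with
  | nil => simp
  | cons a l ih =>
    have hc : Commute (f a) (l.map f).prod := Commute.list_prod_right _ _ fun x hx => by
      obtain ⟨i, hi, rfl⟩ := List.mem_map.1 hx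
      exact h a List.mem_cons_self i (List.mem_cons_of_mem _ hi)
    have ih' := ih fun i hi j hj => h i (List.mem_cons_of_mem _ hi) j (List.mem_cons_of_mem _ hj)
    rw [List.map_cons, List.prod_cons, Ring.mul_inverse_rev' hc, hc.ringInverse_ringInverse.symm.eq,
      ih', List.map_cons, List.prod_cons]

theorem map_ring_inverse {R R' : Type} [Semiring R] [Semiring R'] [Algebra ℂ R] [Algebra ℂ R']
    (φ : R ≃ₐ[ℂ] R') (x : R) : φ (Ring.inverse x) = Ring.inverse (φ x) := by
  by_cases hx : IsUnit x
  · obtain ⟨u, rfl⟩ := hx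
    rw [Ring.inverse_unit]
    exact (Ring.inverse_unit (Units.map (φ : R →* R') u)).symm
  · rw [Ring.inverse_non_unit _ hx, Ring.inverse_non_unit, map_zero]
    exact fun h => hx ((MulEquiv.isUnit_map φ).1 h)

theorem commute_ring_inverse {R : Type} [MonoidWithZero R] {a b : R} (h : Commute a b) :
    Commute a (Ring.inverse b) := by
  by_cases hb : IsUnit b
  · obtain ⟨u, rfl⟩ := hb
    rw [Ring.inverse_unit]
    exact h.units_inv_right
  · rw [Ring.inverse_non_unit _ hb]
    exact Commute.zero_right a

end Commuting

/-! ### Duality for the difference operators -/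

section Difference

variable {k n : ℕ}

theorem mem_above {m : ℕ} {i j : Fin m} (h : j ∈ above i) : i < j := by
  simpa [above] using h

theorem mem_below {m : ℕ} {i j : Fin m} (h : j ∈ below i) : j < i := by
  simpa [below] using h

/-- Every factor of `X_i` has weight zero, so the `C` factors of `N_i` slide through it: the inverse
ones join the inverted `B` factors on the left, the others join those on the right. Invertibility is
not needed, since `Ring.inverse` is compatible with commuting products. -/
theorem NN_mul_XX {κ : ℂ} {i : Fin n} {z : Fin n → ℂ} (hz : DiffReg κ i z) (lam : Fin k → ℂ) :
    NN k κ i z * XX κ i lam z =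
      Ring.inverse (((above i).map fun j => CC k i j (z i - z j)).prod *
          ((above i).map fun j => BB k i j (z i - z j)).prod) *
        ((List.finRange k).map fun a => onFactor a (opFun (fun μ => lam a ^ (-μ)) (e i i))).prod *
        (((below i).map fun j => CC k j i (z j - z i - κ)).prod *
          ((below i).map fun j => BB k j i (z j - z i - κ)).prod) := by
  have cA : ∀ c, Commute ((above i).map fun j => BB k i j (z i - z j)).prod (eTot k c c) :=
    fun c => Commute.list_prod_left _ _ fun x hx => by
      obtain ⟨j, hj, rfl⟩ := List.mem_map.1 hx
      exact commute_BB_eTot (mem_above hj).ne (hz.1 j (mem_above hj)) c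
  have cM : ∀ c, Commute ((List.finRange k).map fun a =>
      onFactor a (opFun (fun μ => lam a ^ (-μ)) (e i i))).prod (eTot k c c) :=
    fun c => Commute.list_prod_left _ _ fun x hx => by
      obtain ⟨a, _, rfl⟩ := List.mem_map.1 hx
      exact commute_opFun_eTot a _ i c
  have cC : ∀ c, Commute ((above i).map fun j => CC k i j (z i - z j)).prod (eTot k c c) :=
    fun c => Commute.list_prod_left _ _ fun x hx => by
      obtain ⟨j, _, rfl⟩ := List.mem_map.1 hx
      exact commute_CC_eTot _ _ c _
  have cP : ∀ A : Module.End ℂ (TT n k), (∀ c, Commute A (eTot k c c)) →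
      Commute A ((above i).map fun j => CC k i j (z i - z j)).prod :=
    fun A hA => Commute.list_prod_right _ _ fun x hx => by
      obtain ⟨j, _, rfl⟩ := List.mem_map.1 hx
      exact commute_CC hA _ _ _
  have cQ : ∀ A : Module.End ℂ (TT n k), (∀ c, Commute A (eTot k c c)) →
      Commute A ((below i).map fun j => CC k j i (z j - z i - κ)).prod :=
    fun A hA => Commute.list_prod_right _ _ fun x hx => by
      obtain ⟨j, _, rfl⟩ := List.mem_map.1 hx
      exact commute_CC hA _ _ _
  have hinv := inverse_list_prod (f := fun j => CC k i j (z i - z j)) (above i)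
    fun j _ j' _ => commute_CC (fun c => commute_CC_eTot _ _ c _) _ _ _
  rw [NN, XX, ← hinv, Ring.mul_inverse_rev' (cP _ cA).symm]
  generalize ((above i).map fun j => BB k i j (z i - z j)).prod = PB at *
  generalize ((above i).map fun j => CC k i j (z i - z j)).prod = PC at *
  generalize ((below i).map fun j => CC k j i (z j - z i - κ)).prod = QC at *
  generalize ((below i).map fun j => BB k j i (z j - z i - κ)).prod = QB at *
  generalize ((List.finRange k).map fun a =>
    onFactor a (opFun (fun μ => lam a ^ (-μ)) (e i i))).prod = D at *
  have cAi : ∀ c, Commute (Ring.inverse PB) (eTot k c c) :=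
    fun c => (commute_ring_inverse (cA c).symm).symm
  have cCi : ∀ c, Commute (Ring.inverse PC) (eTot k c c) :=
    fun c => (commute_ring_inverse (cC c).symm).symm
  have q := cQ _ fun c => ((cAi c).mul_left (cCi c)).mul_left (cM c)
  have r := commute_ring_inverse (cP _ cAi)
  rw [← mul_assoc _ QC QB, q.eq, r.eq]
  simp only [mul_assoc]

theorem opK_prod_RR [NeZero k] (l : List (Fin n)) {a b : Fin n → Fin n} {t : Fin n → ℂ}
    (hab : ∀ j ∈ l, a j ≠ b j) (ht : ∀ j ∈ l, ∀ s : ℤ, t j ≠ s) :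
    opK k n (l.map fun j => RR (a j) (b j) (t j)).prod =
      opN k n ((l.map fun j => CC k (a j) (b j) (t j)).prod *
        (l.map fun j => BB k (a j) (b j) (t j)).prod) := by
  rw [← list_prod_map_mul, map_list_prod, map_list_prod, List.map_map, List.map_map]
  · congr 1
    refine List.map_congr_left fun j hj => ?_
    rw [Function.comp_apply, Function.comp_apply, opK_RR (hab j hj) (ht j hj)]
  · intro j _ j' hj'
    exact (commute_CC (commute_BB_eTot (hab j' hj') (ht j' hj')) _ _ _).symm

/-- Both sides are diagonal on monomials and see only the exponents of the variables `x_{ai}`. -/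
theorem opK_prod_opFun (i : Fin n) (f : Fin k → ℂ → ℂ) (l : List (Fin k)) :
    opK k n (l.map fun a => onFactor i (opFun (f a) (e a a))).prod =
      opN k n (l.map fun a => onFactor a (opFun (f a) (e i i))).prod := by
  rw [map_list_prod, map_list_prod, List.map_map, List.map_map]
  congr 1
  refine List.map_congr_left fun a _ => linearMap_ext_monomial fun s => ?_
  rw [Function.comp_apply, Function.comp_apply, opIso_onFactor_opFun, opIso_onFactor_opFun]
  rfl

theorem opK_KK [NeZero k] {κ : ℂ} {i : Fin n} {z : Fin n → ℂ} (hz : DiffReg κ i z)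
    (lam : Fin k → ℂ) : opK k n (KK κ i z lam) = opN k n (NN k κ i z * XX κ i lam z) := by
  rw [NN_mul_XX hz, KK, map_mul, map_mul, map_ring_inverse,
    opK_prod_RR (above i) (a := fun _ => i) (fun j hj => (mem_above hj).ne)
      fun j hj => hz.1 j (mem_above hj),
    opK_prod_RR (below i) (b := fun _ => i) (fun j hj => (mem_below hj).ne)
      fun j hj => hz.2 j (mem_below hj),
    opK_prod_opFun i (fun a μ => lam a ^ (-μ)), ← map_ring_inverse, ← map_mul, ← map_mul]

end Difference

/-! ### Duality for the differential operators -/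

section Differential

variable {k n : ℕ}

theorem opIso_sub {σ : Type} (g : Fin n × Fin k ≃ σ) (A B : Module.End ℂ (TT k n)) :
    opIso g (A - B) = opIso g A - opIso g B :=
  LinearMap.ext fun p => map_sub (polyIso g) (A ((polyIso g).symm p)) (B ((polyIso g).symm p))

/-- The differential operator `X_s X_s' ∂_r ∂_r'`. -/
def normalOrdered {σ : Type} (s s' r r' : σ) : Module.End ℂ (MvPolynomial σ ℂ) :=
  mX s * mX s' * (dX r * dX r')

theorem normalOrdered_comm {σ : Type} (s s' r r' : σ) :
    normalOrdered s s' r r' = normalOrdered s s' r' r := by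
  rw [normalOrdered, dX_mul_dX, normalOrdered]

theorem mul_eq_normalOrdered {σ : Type} [DecidableEq σ] (s s' r r' : σ) :
    mX s * dX r * (mX s' * dX r') =
      normalOrdered s s' r r' + if r = s' then mX s * dX r' else 0 := by
  rw [mul_assoc, ← mul_assoc (dX r), dX_mul_mX, add_mul, mul_add, normalOrdered]
  split_ifs <;> simp [mul_assoc]

theorem exchange {i j : Fin n} (h : i ≠ j) (a b : Fin k) :
    mX (a, i) * dX (b, i) * (mX (b, j) * dX (a, j)) =
      (mX (a, i) * dX (a, j) * (mX (b, j) * dX (b, i)) - if a = b then mX (a, i) * dX (a, i) else 0 :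
        Module.End ℂ (PP k n)) := by
  rw [mul_eq_normalOrdered, mul_eq_normalOrdered, normalOrdered_comm, if_neg (by simp [h])]
  by_cases hab : a = b
  · subst hab; simp
  · simp [hab]

/-- The corrections at `a = b` in `exchange` add up to `e_ii` of `gl_n`. -/
theorem opK_Om {i j : Fin n} (h : i ≠ j) :
    opK k n (Om i j) = opN k n (eTot k i j * eTot k j i - eTot k i i) := by
  simp only [Om, eTot, opIso_sub, map_sum, map_mul, opK_eAt, opN_eAt]
  rw [Finset.sum_mul_sum, ← Finset.sum_sub_distrib]
  refine Finset.sum_congr rfl fun a _ => ?_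
  have : mX (a, i) * dX (a, i) = ∑ b, if a = b then mX (a, i) * dX (a, i) else
      (0 : Module.End ℂ (PP k n)) := by simp
  rw [this, ← Finset.sum_sub_distrib]
  exact Finset.sum_congr rfl fun b _ => exchange h a b

theorem opK_diag (i : Fin n) (lam : Fin k → ℂ) :
    opK k n (∑ a, lam a • eAt i a a) = opN k n (∑ a, lam a • eAt a i i) := by
  simp only [map_sum, map_smul, opK_eAt, opN_eAt]

theorem opK_ratKZ (i : Fin n) {z : Fin n → ℂ} :
    opK k n (∑ j with j ≠ i, (1 / (z i - z j)) • Om i j) =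
      opN k n (∑ b with b ≠ i, (1 / (z i - z b)) • (eTot k i b * eTot k b i - eTot k i i)) := by
  rw [map_sum, map_sum]
  refine Finset.sum_congr rfl fun j hj => ?_
  rw [map_smul, map_smul, opK_Om (Ne.symm (Finset.mem_filter.1 hj).2)]

theorem sum_sum_eq_of_symm {ι A : Type} [Fintype ι] [LinearOrder ι] [AddCommGroup A] [Module ℂ A]
    (f : ι → ι → A) (hf : ∀ a b, f a b = f b a) :
    ∑ a, ∑ b, f a b = ∑ a, f a a + (2 : ℂ) • ∑ a, ∑ b with a < b, f a b := by
  have h : ∀ a b, f a b = (if a = b then f a b else 0) +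
      ((if a < b then f a b else 0) + if b < a then f b a else 0) := by
    intro a b
    rcases lt_trichotomy a b with h | h | h
    · simp [h, h.ne, h.not_gt]
    · subst h; simp
    · simp [h, h.ne', h.not_gt, hf a b]
  have h2 : ∑ a, ∑ b, (if b < a then f b a else 0) = ∑ a, ∑ b, if a < b then f a b else 0 :=
    Finset.sum_comm
  calc ∑ a, ∑ b, f a b = ∑ a, ∑ b, ((if a = b then f a b else 0) +
      ((if a < b then f a b else 0) + if b < a then f b a else 0)) :=
        Finset.sum_congr rfl fun a _ => Finset.sum_congr rfl fun b _ => h a b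
    _ = _ := by
      simp only [Finset.sum_add_distrib, h2, two_smul, Finset.sum_filter]
      simp

theorem commute_number (a b : Fin k) (j j' : Fin n) :
    mX (a, j) * dX (a, j) * (mX (b, j') * dX (b, j')) =
      (mX (b, j') * dX (b, j') * (mX (a, j) * dX (a, j)) : Module.End ℂ (PP k n)) := by
  refine linearMap_ext_monomial fun s => ?_
  rw [Module.End.mul_apply (_ * _), Module.End.mul_apply (_ * _)]
  simp only [mX_mul_dX_self_monomial, map_smul]
  rw [smul_comm]

/-- The total `e_aa` is split into its part at `i`, which yields squares, and the parts at `j ≠ i`,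
which will cancel the diagonal half of `Ω_+`. -/
theorem opK_diag_sub (i : Fin n) (lam : Fin k → ℂ) :
    opK k n (∑ a, (lam a • 1 - (1 / 2 : ℂ) • eTot n a a) * eAt i a a) =
      opN k n (∑ a, lam a • eAt a i i) - (1 / 2 : ℂ) •
        (∑ a, mX (a, i) * dX (a, i) * (mX (a, i) * dX (a, i)) +
          ∑ j with j ≠ i, ∑ a, mX (a, i) * dX (a, i) * (mX (a, j) * dX (a, j))) := by
  have h : ∑ a, mX (a, i) * dX (a, i) * (mX (a, i) * dX (a, i)) +
      ∑ j with j ≠ i, ∑ a, mX (a, i) * dX (a, i) * (mX (a, j) * dX (a, j)) =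
      (∑ a, ∑ j, mX (a, j) * dX (a, j) * (mX (a, i) * dX (a, i)) : Module.End ℂ (PP k n)) := by
    rw [Finset.filter_ne', Finset.add_sum_erase _
      (fun j => ∑ a, mX (a, i) * dX (a, i) * (mX (a, j) * dX (a, j))) (Finset.mem_univ i),
      Finset.sum_comm]
    exact Finset.sum_congr rfl fun a _ => Finset.sum_congr rfl fun j _ => commute_number a a i j
  rw [h, map_sum, map_sum, Finset.smul_sum, ← Finset.sum_sub_distrib]
  refine Finset.sum_congr rfl fun a _ => ?_
  have h1 : opK k n (lam a • 1) = lam a • 1 := by rw [map_smul, map_one]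
  have h2 : opK k n ((1 / 2 : ℂ) • eTot n a a) = (1 / 2 : ℂ) • ∑ j, mX (a, j) * dX (a, j) := by
    rw [map_smul, eTot, map_sum]
    simp only [opK_eAt]
  have h3 : opN k n (lam a • eAt a i i) = lam a • (mX (a, i) * dX (a, i)) := by
    rw [map_smul, opN_eAt]
  rw [map_mul, opIso_sub, h1, h2, h3, opK_eAt, sub_mul, smul_mul_assoc, one_mul, smul_mul_assoc,
    Finset.sum_mul]

/-- Off the diagonal `a < b`, so the exchange has no correction term. -/
theorem opK_OmPlus {i j : Fin n} (h : i ≠ j) :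
    opK k n (OmPlus i j) = (1 / 2 : ℂ) • ∑ a, mX (a, i) * dX (a, i) * (mX (a, j) * dX (a, j)) +
      ∑ a : Fin k, ∑ b : Fin k with a < b, mX (a, i) * dX (a, j) * (mX (b, j) * dX (b, i)) := by
  have h1 : ∑ a : Fin k, ∑ b : Fin k with a < b, mX (a, i) * dX (b, i) * (mX (b, j) * dX (a, j)) =
      (∑ a : Fin k, ∑ b : Fin k with a < b, mX (a, i) * dX (a, j) * (mX (b, j) * dX (b, i)) :
        Module.End ℂ (PP k n)) := by
    refine Finset.sum_congr rfl fun a _ => Finset.sum_congr rfl fun b hb => ?_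
    rw [exchange h, if_neg (Finset.mem_filter.1 hb).2.ne, sub_zero]
  rw [← h1]
  simp only [OmPlus, map_add, map_smul, map_sum, map_mul, opK_eAt]

theorem opN_sq (i : Fin n) : opN k n ((1 / 2 : ℂ) • (eTot k i i) ^ 2) =
    (1 / 2 : ℂ) • ∑ a, mX (a, i) * dX (a, i) * (mX (a, i) * dX (a, i)) +
      ∑ a : Fin k, ∑ b : Fin k with a < b, mX (a, i) * dX (a, i) * (mX (b, i) * dX (b, i)) := by
  have h : opN k n (eTot k i i) = ∑ a, mX (a, i) * dX (a, i) := by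
    rw [eTot, map_sum]
    exact Finset.sum_congr rfl fun a _ => opN_eAt a i i
  rw [map_smul, sq, map_mul, h, Finset.sum_mul_sum, sum_sum_eq_of_symm _ fun a b =>
    commute_number a b i i, smul_add, smul_smul]
  norm_num

/-- The term `j = i` is isolated because it cancels the cross terms of `e_ii² / 2`. -/
theorem opN_sum_pairs (i : Fin n) :
    opN k n (∑ j : Fin n, ∑ a : Fin k, ∑ b : Fin k with a < b, eAt a i j * eAt b j i) =
      ∑ a : Fin k, ∑ b : Fin k with a < b, mX (a, i) * dX (a, i) * (mX (b, i) * dX (b, i)) +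
        ∑ j with j ≠ i, ∑ a : Fin k, ∑ b : Fin k with a < b,
          mX (a, i) * dX (a, j) * (mX (b, j) * dX (b, i)) := by
  rw [Finset.filter_ne', Finset.add_sum_erase _ (fun j => ∑ a : Fin k, ∑ b : Fin k with a < b,
    mX (a, i) * dX (a, j) * (mX (b, j) * dX (b, i))) (Finset.mem_univ i)]
  simp only [map_sum, map_mul, opN_eAt]

theorem opK_rTrig {i j : Fin n} (h : i ≠ j) {x y : ℂ} (hy : y ≠ 0) (hxy : x ≠ y) :
    opK k n (rTrig (x / y) i j) =
      opN k n ((y / (x - y)) • (eTot k i j * eTot k j i - eTot k i i)) + opK k n (OmPlus i j) := by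
  have hne : x - y ≠ 0 := sub_ne_zero.2 hxy
  -- This is how the coefficient `z_j / (z_i - z_j)` of the dynamical operator arises from the pole
  -- of `r(z_i / z_j)`.
  have hc : 1 / (x / y - 1) = y / (x - y) := by field_simp
  rw [rTrig, map_add, map_smul, map_smul, opK_Om h, hc]

theorem opK_trigKZ (i : Fin n) {z : Fin n → ℂ} (hz : TrigReg i z) (lam : Fin k → ℂ) :
    opK k n (∑ a, (lam a • 1 - (1 / 2 : ℂ) • eTot n a a) * eAt i a a) +
        opK k n (∑ j with j ≠ i, rTrig (z i / z j) i j) =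
      -opN k n ((1 / 2 : ℂ) • (eTot k i i) ^ 2) + opN k n (∑ a, lam a • eAt a i i) +
        opN k n (∑ j : Fin n, ∑ a : Fin k, ∑ b : Fin k with a < b, eAt a i j * eAt b j i) +
        opN k n (∑ j with j ≠ i, (z j / (z i - z j)) • (eTot k i j * eTot k j i - eTot k i i)) := by
  have hr : opK k n (∑ j with j ≠ i, rTrig (z i / z j) i j) =
      opN k n (∑ j with j ≠ i, (z j / (z i - z j)) • (eTot k i j * eTot k j i - eTot k i i)) +
        ((1 / 2 : ℂ) • ∑ j with j ≠ i, ∑ a, mX (a, i) * dX (a, i) * (mX (a, j) * dX (a, j)) +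
        ∑ j with j ≠ i, ∑ a : Fin k, ∑ b : Fin k with a < b,
          mX (a, i) * dX (a, j) * (mX (b, j) * dX (b, i))) := by
    rw [map_sum, map_sum, Finset.smul_sum, ← Finset.sum_add_distrib, ← Finset.sum_add_distrib]
    refine Finset.sum_congr rfl fun j hj => ?_
    have hj := (Finset.mem_filter.1 hj).2
    rw [opK_rTrig hj.symm (hz j hj).1 (hz j hj).2, opK_OmPlus hj.symm]
  rw [hr, opK_diag_sub, opN_sq, opN_sum_pairs]
  module

end Differential

/-! ### Transport of functions -/

section Functions

/-- Linear functionals separate points, so a weak derivative is unique. -/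
theorem vderiv_eq {M : Type} [AddCommGroup M] [Module ℂ M] {f : ℂ → M} {x : ℂ} {v : M}
    (h : ∀ φ : Module.Dual ℂ M, HasDerivAt (fun y => φ (f y)) (φ v) x) : vderiv f x = v := by
  have hex : ∃ v : M, ∀ φ : Module.Dual ℂ M, HasDerivAt (fun y => φ (f y)) (φ v) x := ⟨v, h⟩
  rw [vderiv, dif_pos hex, ← sub_eq_zero, ← Module.forall_dual_apply_eq_zero_iff ℂ]
  intro φ
  rw [map_sub, (hex.choose_spec φ).unique (h φ), sub_self]

/-- An isomorphism is needed so that existence of the derivative transfers both ways; when it fails,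
both sides take the default value zero. -/
theorem map_vderiv {M M' : Type} [AddCommGroup M] [Module ℂ M] [AddCommGroup M'] [Module ℂ M']
    (L : M ≃ₗ[ℂ] M') (f : ℂ → M) (x : ℂ) : L (vderiv f x) = vderiv (fun y => L (f y)) x := by
  by_cases h : ∃ v : M, ∀ φ : Module.Dual ℂ M, HasDerivAt (fun y => φ (f y)) (φ v) x
  · obtain ⟨v, hv⟩ := h
    rw [vderiv_eq hv]
    exact (vderiv_eq fun φ => hv (φ ∘ₗ L.toLinearMap)).symm
  · rw [vderiv, dif_neg h, map_zero, vderiv, dif_neg]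
    rintro ⟨v, hv⟩
    refine h ⟨L.symm v, fun φ => ?_⟩
    simpa using hv (φ ∘ₗ L.symm.toLinearMap)

variable {k n : ℕ}

theorem kIso_apply (A : Module.End ℂ (TT k n)) (p : PP k n) :
    kIso k n (A ((kIso k n).symm p)) = opK k n A p := rfl

theorem nIso_apply (A : Module.End ℂ (TT n k)) (p : PP k n) :
    nIso k n (A ((nIso k n).symm p)) = opN k n A p := rfl

theorem kIso_dz (i : Fin n) (u : Fn k n (PP k n)) (z : Fin n → ℂ) (lam : Fin k → ℂ) :
    kIso k n (dz i (fun z' lam' => (kIso k n).symm (u z' lam')) z lam) = dz i u z lam := by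
  rw [dz, map_vderiv]
  simp only [LinearEquiv.apply_symm_apply]
  rfl

theorem nIso_dlam (i : Fin n) (u : Fn k n (PP k n)) (z : Fin n → ℂ) (lam : Fin k → ℂ) :
    nIso k n (dlam i (fun lam' z' => (nIso k n).symm (u z' lam')) lam z) = dz i u z lam := by
  rw [dlam, map_vderiv]
  simp only [LinearEquiv.apply_symm_apply]
  rfl

/-- The isomorphism of `P_nk` and `P_kn` exchanging the two indices of the variables. -/
def swapIso (k n : ℕ) : PP n k ≃ₐ[ℂ] PP k n :=
  MvPolynomial.renameEquiv ℂ (Equiv.prodComm (Fin n) (Fin k))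

theorem swapIso_nIso (v : TT k n) : swapIso k n (nIso n k v) = kIso k n v := by
  have h : (swapIso k n).toLinearMap ∘ₗ (nIso n k).toLinearMap = (kIso k n).toLinearMap := by
    refine PiTensorProduct.ext (MultilinearMap.ext fun p => ?_)
    refine (congrArg (swapIso k n) (polyIso_tprod (Equiv.refl _) p)).trans ?_
    refine Eq.trans ?_ (polyIso_tprod (Equiv.prodComm _ _) p).symm
    rw [map_prod]
    refine Finset.prod_congr rfl fun i _ => ?_
    exact MvPolynomial.rename_rename _ _ _
  exact LinearMap.congr_fun h v

theorem swapIso_kIso (v : TT n k) : swapIso k n (kIso n k v) = nIso k n v := by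
  have h : (swapIso k n).toLinearMap ∘ₗ (kIso n k).toLinearMap = (nIso k n).toLinearMap := by
    refine PiTensorProduct.ext (MultilinearMap.ext fun p => ?_)
    refine (congrArg (swapIso k n) (polyIso_tprod (Equiv.prodComm _ _) p)).trans ?_
    refine Eq.trans ?_ (polyIso_tprod (Equiv.refl _) p).symm
    rw [map_prod]
    refine Finset.prod_congr rfl fun i _ => ?_
    exact MvPolynomial.rename_rename _ _ _
  exact LinearMap.congr_fun h v

theorem nIso_symm_swapIso_symm (p : PP k n) :
    (nIso n k).symm ((swapIso k n).symm p) = (kIso k n).symm p := by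
  rw [LinearEquiv.symm_apply_eq, AlgEquiv.symm_apply_eq, swapIso_nIso, LinearEquiv.apply_symm_apply]

theorem kIso_symm_swapIso_symm (p : PP k n) :
    (kIso n k).symm ((swapIso k n).symm p) = (nIso k n).symm p := by
  rw [LinearEquiv.symm_apply_eq, AlgEquiv.symm_apply_eq, swapIso_kIso, LinearEquiv.apply_symm_apply]

/-- Exchange of the roles of `(k, z, λ)` and `(n, λ, z)`. -/
theorem SimOn.swap {S : (Fin k → ℂ) → (Fin n → ℂ) → Prop}
    {F : Fn n k (TT n k) → Fn n k (TT n k)} {G : Fn k n (TT k n) → Fn k n (TT k n)}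
    (h : SimOn (k := n) (n := k) S F G) :
    SimOn (k := k) (n := n) (fun z lam => S lam z) G F := by
  intro u z lam hS
  have hu := h (fun lam' z' => (swapIso k n).symm (u z' lam')) lam z hS
  have := congrArg (swapIso k n) hu.symm
  simpa only [actK, actN, swapIso_nIso, swapIso_kIso, nIso_symm_swapIso_symm,
    kIso_symm_swapIso_symm] using this

/-! ### The three dualities for the operators in `z_i`. -/

theorem simOn_ratKZ (κ : ℂ) (i : Fin n) :
    SimOn (k := k) (n := n) (fun z _ => RatReg i z) (ratKZ κ i) (ratDD κ i) := by
  intro u z lam _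
  simp only [actK, actN, ratKZ, ratDD, map_sub, map_smul, kIso_dz, nIso_dlam, kIso_apply, nIso_apply,
    opK_diag]
  rw [opK_ratKZ]

theorem simOn_trigKZ (κ : ℂ) (i : Fin n) :
    SimOn (k := k) (n := n) (fun z _ => TrigReg i z) (trigKZ κ i) (trigDD κ i) := by
  intro u z lam hz
  simp only [actK, actN, trigKZ, trigDD, map_sub, map_add, map_smul, kIso_dz, nIso_dlam, kIso_apply,
    nIso_apply]
  have h := LinearMap.congr_fun (opK_trigKZ i hz lam) (u z lam)
  simp only [LinearMap.add_apply, LinearMap.neg_apply] at h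
  rw [sub_sub, h]
  simp only [map_smul, LinearMap.smul_apply]
  abel

theorem simOn_ratQKZ [NeZero k] (κ : ℂ) (i : Fin n) :
    SimOn (k := k) (n := n) (fun z lam => DiffReg κ i z ∧ ∀ b, lam b ≠ 0)
      (ratQKZ κ i) (normQDD κ i) := by
  intro u z lam hz
  simp only [actK, actN, ratQKZ, normQDD, ratQDD, kIso_apply, opK_KK hz.1]
  rw [← Module.End.mul_apply, nIso_apply]

end Functions

end KZDuality
end

theorem mainTheorem3 (k n : ℕ) [NeZero k] [NeZero n] (κ : ℂ) (hκ : κ ≠ 0)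
    (i : Fin n) (a : Fin k) :
    (SimOn (k := k) (n := n) (fun z _ => RatReg i z) (ratKZ κ i) (ratDD κ i) ∧
      SimOn (k := k) (n := n) (fun _ lam => RatReg a lam) (ratDD κ a) (ratKZ κ a)) ∧
    (SimOn (k := k) (n := n) (fun z _ => TrigReg i z) (trigKZ κ i) (trigDD κ i) ∧
      SimOn (k := k) (n := n) (fun _ lam => TrigReg a lam) (trigDD κ a) (trigKZ κ a)) ∧
    (SimOn (k := k) (n := n) (fun z lam => DiffReg κ i z ∧ ∀ b, lam b ≠ 0)
        (ratQKZ κ i) (normQDD κ i) ∧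
      SimOn (k := k) (n := n) (fun z lam => DiffReg κ a lam ∧ ∀ j, z j ≠ 0)
        (normQDD κ a) (ratQKZ κ a)) := by
  exact ⟨⟨simOn_ratKZ κ i, (simOn_ratKZ κ a).swap⟩, ⟨simOn_trigKZ κ i, (simOn_trigKZ κ a).swap⟩,
    simOn_ratQKZ κ i, (simOn_ratQKZ κ a).swap⟩
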